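/- Varieties are varieties of (nonempty) algebras of an arbitrary finitary similarity type. For varieties $\mathcal U,\mathcal V$ write $\mathcal U\le\mathcal V$ if there is an interpretation of $\mathcal U$ into $\mathcal V$, that is, a homomorphism from the clone of $\mathcal U$ to the clone of $\mathcal V$. This is a preorder; its equivalence classes are called interpretability classes, and they form a lattice $\mathcal L$ (a proper class) in which every set of elements has a join. Let $\mathcal C$ be the collection of interpretability classes of idempotent, finitely presentable varieties, and for $u,v\in\mathcal L$ write $u\le_{\mathcal C}v$ if $w\le u$ implies $w\le v$ for all $w\in\mathcal C$. An *idempotent Mal'cev filter* is a filter $F$ of $\mathcal L$ which is also a filter with respect to $\le_{\mathcal C}$ and which is compact: whenever $S\subseteq\mathcal C$ and $\bigvee S\in F$, there is a finite $S_0\subseteq S$ with $\bigvee S_0\in F$. An *idempotent Mal'cev condition* is an assertion "the interpretability class of $\mathcal V$ belongs to $F$", where $F$ is an idempotent Mal'cev filter; it is *nontrivial* if $F\ne\mathcal L$. A *congruence equation* is an equation between terms in the symbols $\vee,\wedge,\circ$. Its variables are interpreted as congruences of an algebra, $\wedge$ as intersection and $\circ$ as composition of binary relations, and $\vee$ as join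 of congruences (for arbitrary binary relations $R,S$ on the algebra, $R\vee S$ is the least congruence containing $R\cup S$). A variety *satisfies* a congruence equation if the equation holds for all congruences of each member of the variety. A congruence equation is *trivial* if it holds for all congruences of every algebra, and *nontrivial* otherwise. **Lemma 4.6.** A variety satisfies a nontrivial idempotent Mal'cev condition if and only if it satisfies a nontrivial congruence equation. -/

import Mathlib

universe u

namespace UnivAlg

/-! ### Varieties -/

/-- A variety, given by a similarity type (a first-order language without relation symbols; all
operations are finitary, operation symbols of arity zero are allowed) and a set of identities
between terms in countably many variables. Its members are the nonempty algebras satisfying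
these identities. -/
structure Variety : Type (u + 1) where
  /-- the similarity type -/
  lang : FirstOrder.Language.{u, 0}
  /-- there are no relation symbols -/
  isAlgebraic : lang.IsAlgebraic
  /-- the defining identities -/
  eqns : Set (lang.Term ℕ × lang.Term ℕ)

namespace Variety

/-- The algebra `A` satisfies the defining identities of `V`. -/
def Models (V : Variety.{u}) (A : Type u) [V.lang.Structure A] : Prop :=
  ∀ e ∈ V.eqns, ∀ v : ℕ → A, e.1.realize v = e.2.realize v

/-- The identity `s ≈ t` holds in all members of `V`. -/
def Valid (V : Variety.{u}) {α : Type} (s t : V.lang.Term α) : Prop :=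
  ∀ (A : Type u) [Nonempty A] [V.lang.Structure A], V.Models A →
    ∀ v : α → A, s.realize v = t.realize v

/-- `V` is idempotent: `f(x, …, x) ≈ x` holds in `V` for every basic operation `f`. -/
def IsIdempotent (V : Variety.{u}) : Prop :=
  ∀ (n : ℕ) (f : V.lang.Functions n),
    V.Valid (FirstOrder.Language.Term.func f fun _ => FirstOrder.Language.Term.var (0 : Fin 1)) (FirstOrder.Language.Term.var 0)

/-- `V` is finitely presented: finitely many operation symbols, finitely many identities. -/
def IsFinitelyPresented (V : Variety.{u}) : Prop :=
  Finite (Σ n : ℕ, V.lang.Functions n) ∧ V.eqns.Finite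

/-! ### Clones and interpretations -/

/-- Two `n`-ary terms are identified when they agree in all members of `V`. -/
def termSetoid (V : Variety.{u}) (n : ℕ) : Setoid (V.lang.Term (Fin n)) where
  r s t := V.Valid s t
  iseqv :=
    { refl := fun _ _ _ _ _ _ => rfl
      symm := fun h A _ _ hA v => (h A hA v).symm
      trans := fun h k A _ _ hA v => (h A hA v).trans (k A hA v) }

/-- The `n`-ary part of the clone of `V`: the `n`-ary term operations of `V`. -/
def Clone (V : Variety.{u}) (n : ℕ) : Type u := Quotient (V.termSetoid n)

/-- The `i`-th `n`-ary projection. -/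
def cloneProj (V : Variety.{u}) {n : ℕ} (i : Fin n) : V.Clone n :=
  Quotient.mk (V.termSetoid n) (FirstOrder.Language.Term.var i)

theorem valid_subst (V : Variety.{u}) {n m : ℕ} {s t : V.lang.Term (Fin n)} (h : V.Valid s t)
    {g k : Fin n → V.lang.Term (Fin m)} (hg : ∀ i, V.Valid (g i) (k i)) :
    V.Valid (s.subst g) (t.subst k) := by
  intro A _ _ hA v
  rw [FirstOrder.Language.Term.realize_subst, FirstOrder.Language.Term.realize_subst, h A hA]
  congr 1
  funext i
  exact hg i A hA v

/-- Composition `f(g₁, …, gₙ)` in the clone of `V`. It is defined through representatives; the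
choice is immaterial, see `cloneComp_mk`. -/
noncomputable def cloneComp (V : Variety.{u}) {n m : ℕ} (f : V.Clone n) (g : Fin n → V.Clone m) :
    V.Clone m :=
  Quotient.mk (V.termSetoid m) ((Quotient.out f).subst fun i => Quotient.out (g i))

theorem cloneComp_mk (V : Variety.{u}) {n m : ℕ} (t : V.lang.Term (Fin n))
    (s : Fin n → V.lang.Term (Fin m)) :
    V.cloneComp (Quotient.mk (V.termSetoid n) t) (fun i => Quotient.mk (V.termSetoid m) (s i)) =
      Quotient.mk (V.termSetoid m) (t.subst s) := by
  refine Quotient.sound (V.valid_subst ?_ fun i => ?_)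
  · exact Quotient.exact (s := V.termSetoid n) (Quotient.out_eq _)
  · exact Quotient.exact (s := V.termSetoid m) (Quotient.out_eq _)

/-- An interpretation of `U` into `V`: a homomorphism from the clone of `U` to the clone of `V`,
that is, an arity-preserving map which preserves projections and composition. As usual, clones
consist of operations of positive arity; a constant symbol contributes constant operations. -/
structure Interpretation (U V : Variety.{u}) where
  /-- the underlying map -/
  toFun : ∀ n : ℕ+, U.Clone n → V.Clone n
  map_proj : ∀ (n : ℕ+) (i : Fin n), toFun n (U.cloneProj i) = V.cloneProj i
  map_comp : ∀ (n m : ℕ+) (f : U.Clone n) (g : Fin n → U.Clone m),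
    toFun m (U.cloneComp f g) = V.cloneComp (toFun n f) fun i => toFun m (g i)

/-- `U ≤ V` means that `U` is interpretable into `V`. -/
instance : Preorder Variety.{u} where
  le U V := Nonempty (Interpretation U V)
  le_refl _ := ⟨⟨fun _ f => f, fun _ _ => rfl, fun _ _ _ _ => rfl⟩⟩
  le_trans U V W := by
    rintro ⟨φ⟩ ⟨ψ⟩
    refine ⟨⟨fun n f => ψ.toFun n (φ.toFun n f), fun n i => ?_, fun n m f g => ?_⟩⟩
    · rw [φ.map_proj, ψ.map_proj]
    · rw [φ.map_comp, ψ.map_comp]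

end Variety

/-! ### Idempotent Mal'cev conditions -/

/-- Interpretability classes of varieties, partially ordered by interpretability. -/
abbrev InterpClass : Type (u + 1) := Antisymmetrization Variety.{u} (· ≤ ·)

/-- The interpretability class of a variety. -/
def Variety.interpClass (V : Variety.{u}) : InterpClass.{u} := toAntisymmetrization (· ≤ ·) V

/-- `F` is a filter with respect to the (pre)order `r`. -/
structure IsFilterFor {P : Type*} (r : P → P → Prop) (F : Set P) : Prop where
  nonempty : F.Nonempty
  up_closed : ∀ x ∈ F, ∀ y, r x y → y ∈ F
  directed : ∀ x ∈ F, ∀ y ∈ F, ∃ z ∈ F, r z x ∧ r z y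

/-- The coarser ordering `≤_C` determined by a collection `C` of interpretability classes. -/
def LeOver (C : Set InterpClass.{u}) (x y : InterpClass.{u}) : Prop :=
  ∀ w ∈ C, w ≤ x → w ≤ y

/-- A `C`-filter: a filter of interpretability classes which is also a filter for `≤_C`. -/
def IsCFilter (C F : Set InterpClass.{u}) : Prop :=
  IsFilterFor (· ≤ ·) F ∧ IsFilterFor (LeOver C) F

/-- `F` is `C`-compact: if the join of a subset `S` of `C` is in `F`, then so is the join of some
finite subset of `S`. -/
def IsCCompact (C F : Set InterpClass.{u}) : Prop :=
  ∀ S ⊆ C, ∀ j, IsLUB S j → j ∈ F → ∃ S₀ ⊆ S, S₀.Finite ∧ ∃ j₀, IsLUB S₀ j₀ ∧ j₀ ∈ F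

/-- The interpretability classes of idempotent, finitely presentable varieties. -/
def idempotentFinPres : Set InterpClass.{u} :=
  {c | ∃ I : Variety.{u}, I.IsIdempotent ∧ I.IsFinitelyPresented ∧ I.interpClass = c}

/-- An idempotent Mal'cev filter: a compact `C`-filter, where `C` is the collection of
interpretability classes of idempotent, finitely presentable varieties. -/
def IsIdempotentMalcevFilter (F : Set InterpClass.{u}) : Prop :=
  IsCFilter idempotentFinPres F ∧ IsCCompact idempotentFinPres F

/-- `V` satisfies a nontrivial idempotent Mal'cev condition: its interpretability class belongs
to an idempotent Mal'cev filter which does not consist of all interpretability classes. -/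
def Variety.SatisfiesNontrivialIdempotentMalcevCondition (V : Variety.{u}) : Prop :=
  ∃ F : Set InterpClass.{u}, IsIdempotentMalcevFilter F ∧ F ≠ Set.univ ∧ V.interpClass ∈ F

/-! ### Congruence equations -/

/-- A congruence of an algebra: an equivalence relation compatible with all operations. -/
structure Congruence (L : FirstOrder.Language.{u, 0}) (A : Type u) [L.Structure A] extends Setoid A where
  compatible : ∀ {n : ℕ} (f : L.Functions n) (x y : Fin n → A), (∀ i, toSetoid.r (x i) (y i)) →
    toSetoid.r (FirstOrder.Language.Structure.funMap f x) (FirstOrder.Language.Structure.funMap f y)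

/-- The join of two binary relations: the least congruence containing both. On congruences this
is the join in the congruence lattice. -/
def joinRel (L : FirstOrder.Language.{u, 0}) {A : Type u} [L.Structure A] (R S : A → A → Prop) :
    A → A → Prop :=
  fun a b => ∀ θ : Congruence L A, (∀ x y, R x y → θ.r x y) → (∀ x y, S x y → θ.r x y) → θ.r a b

/-- Terms in the symbols `∨`, `∧`, `∘`. -/
inductive CongTerm : Type
  | var (i : ℕ) : CongTerm
  | join (s t : CongTerm) : CongTerm
  | meet (s t : CongTerm) : CongTerm
  | comp (s t : CongTerm) : CongTerm

/-- The binary relation on `A` denoted by a term, when the variables denote congruences of `A`: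
`∨` is join of congruences, `∧` is intersection, `∘` is composition of relations. -/
def CongTerm.eval (L : FirstOrder.Language.{u, 0}) {A : Type u} [L.Structure A] (ρ : ℕ → Congruence L A) :
    CongTerm → A → A → Prop
  | var i => (ρ i).r
  | join s t => joinRel L (s.eval L ρ) (t.eval L ρ)
  | meet s t => fun a b => s.eval L ρ a b ∧ t.eval L ρ a b
  | comp s t => Relation.Comp (s.eval L ρ) (t.eval L ρ)

/-- A congruence equation: an equation between terms in the symbols `∨`, `∧`, `∘`. -/
structure CongEquation : Type where
  lhs : CongTerm
  rhs : CongTerm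

/-- The equation `e` holds for all congruences of the algebra `A`. -/
def CongEquation.HoldsIn (e : CongEquation) (L : FirstOrder.Language.{u, 0}) (A : Type u)
    [L.Structure A] : Prop :=
  ∀ ρ : ℕ → Congruence L A, e.lhs.eval L ρ = e.rhs.eval L ρ

/-- `V` satisfies the congruence equation `e`. -/
def Variety.SatisfiesCong (V : Variety.{u}) (e : CongEquation) : Prop :=
  ∀ (A : Type u) [Nonempty A] [V.lang.Structure A], V.Models A → e.HoldsIn V.lang A

/-- A congruence equation is trivial if it holds for the congruences of every algebra, of every
similarity type. (`u` is the universe in which algebras and similarity types live.) -/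
def CongEquation.IsTrivial (e : CongEquation) : Prop :=
  ∀ (L : FirstOrder.Language.{u, 0}) [L.IsAlgebraic] (A : Type u) [Nonempty A] [L.Structure A],
    e.HoldsIn L A

end UnivAlg

/-! Both conditions are equivalent to a third (`satisfiesNontrivialIdempotentMalcevCondition_iff`):
some idempotent, finitely presented `U` interprets into `V` but not into the variety of sets. Sets
are the least interpretability class, so a proper filter omits them. Compactness reduces the join of
all idempotent, finitely presentable classes below `V` to a finite join. Conversely, the principal
filter of `U` is compact because an interpretation of a finitely presented variety into a join uses
only finitely many members of the join (`exists_finset_le_iJoin`).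

From `U` to an equation: all basic operations are merged into one idempotent operation, which is
iterated far enough to express every identity of `U`. Were some coordinate of the result compatible
with all these identities, it would give projections satisfying the identities of `U`, and `U` would
interpret into sets. Hence every coordinate is excluded by a two-variable identity, as for a Taylor
term (`exists_hasTaylorOp`). Such identities yield a congruence inclusion, which fails for
equivalence relations on a finite set (`eval_taylorRight`, `not_eval_taylorRight_generic`).

From an equation to `U`: let the equation fail in an algebra `X`. The pair of points in only one
side is sent to generators of the free algebra of `V` over `X`, where it lies in both sides.
Membership in the other side has a finite witness (`exists_finite_witness`). Its elements become the
operations of `U` and its congruence instances the identities. An interpretation of `U` into sets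
would evaluate the witness in `X`, where there is none (`exists_uniformVariety`). -/

namespace UnivAlg

open FirstOrder FirstOrder.Language

/-! ### Terms, quotients and changes of similarity type -/

section Terms

variable {L : FirstOrder.Language.{u, 0}} {A : Type u} [L.Structure A]

theorem Congruence.realize (θ : Congruence L A) {α : Type*} (t : L.Term α) {v w : α → A}
    (h : ∀ i, θ.r (v i) (w i)) : θ.r (t.realize v) (t.realize w) := by
  induction t with
  | var i => exact h i
  | func f ts ih => exact θ.compatible f _ _ ih

/-- The finite set depends on the term alone and serves all algebras at once. This is what reduces
countably many variables to a finite arity. -/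
theorem exists_finset_support {L : FirstOrder.Language.{u, 0}} {α : Type*} (t : L.Term α) :
    ∃ Y : Finset α, ∀ (A : Type u) [L.Structure A] (v w : α → A), (∀ i ∈ Y, v i = w i) →
      t.realize v = t.realize w := by
  classical
  induction t with
  | var i => exact ⟨{i}, fun A _ v w h => h i (by simp)⟩
  | func f ts ih =>
    choose Y hY using ih
    refine ⟨Finset.univ.biUnion Y, fun A _ v w h => congrArg (Structure.funMap f) ?_⟩
    funext i
    exact hY i A v w fun j hj => h j (Finset.mem_biUnion.2 ⟨i, Finset.mem_univ _, hj⟩)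

end Terms

/-- The structure on the set of terms. -/
abbrev termStructure (L : FirstOrder.Language.{u, 0}) (hL : L.IsAlgebraic) (α : Type*) :
    L.Structure (L.Term α) where
  funMap f ts := Term.func f ts
  RelMap r _ := (hL _).elim r

theorem realize_termStructure {L : FirstOrder.Language.{u, 0}} (hL : L.IsAlgebraic) {α β : Type*}
    (t : L.Term α) (v : α → L.Term β) :
    (letI := termStructure L hL β; t.realize v) = t.subst v := by
  induction t with
  | var i => rfl
  | func f ts ih => exact congrArg (Term.func f) (funext ih)

/-- The quotient of an algebra by a congruence. -/
noncomputable abbrev Congruence.quotientStructure {L : FirstOrder.Language.{u, 0}} (hL : L.IsAlgebraic)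
    {A : Type u} [L.Structure A] (θ : Congruence L A) : L.Structure (Quotient θ.toSetoid) where
  funMap f x := Quotient.mk θ.toSetoid (Structure.funMap f fun i => (x i).out)
  RelMap r _ := (hL _).elim r

theorem Congruence.realize_quotientStructure {L : FirstOrder.Language.{u, 0}} (hL : L.IsAlgebraic)
    {A : Type u} [L.Structure A] (θ : Congruence L A) {α : Type*} (t : L.Term α) (v : α → A) :
    (letI := θ.quotientStructure hL; t.realize fun i => Quotient.mk θ.toSetoid (v i)) =
      Quotient.mk θ.toSetoid (t.realize v) := by
  induction t with
  | var i => rfl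
  | func f ts ih =>
    refine Quotient.sound (θ.compatible f _ _ fun i => ?_)
    refine Quotient.exact (s := θ.toSetoid) ?_
    rw [Quotient.out_eq]
    exact ih i

/-- The structure obtained from a map of similarity types. -/
abbrev mapStructure {L L' : FirstOrder.Language.{u, 0}} (hL : L.IsAlgebraic)
    (φ : ∀ n, L.Functions n → L'.Functions n) (A : Type*) [L'.Structure A] : L.Structure A where
  funMap f x := Structure.funMap (φ _ f) x
  RelMap r _ := (hL _).elim r

/-- The translation of terms along a map of similarity types. -/
def mapTerm {L L' : FirstOrder.Language.{u, 0}} (φ : ∀ n, L.Functions n → L'.Functions n)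
    {α : Type*} : L.Term α → L'.Term α
  | .var i => .var i
  | .func f ts => .func (φ _ f) fun i => mapTerm φ (ts i)

theorem realize_mapTerm {L L' : FirstOrder.Language.{u, 0}} (hL : L.IsAlgebraic)
    (φ : ∀ n, L.Functions n → L'.Functions n) {A : Type*} [L'.Structure A] {α : Type*}
    (t : L.Term α) (v : α → A) :
    (mapTerm φ t).realize v = (letI := mapStructure hL φ A; t.realize v) := by
  induction t with
  | var i => rfl
  | func f ts ih => exact congrArg (Structure.funMap (φ _ f)) (funext ih)

/-! ### Interpretations as reducts of models -/

namespace Variety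

/-- A choice of a term of `V` for every basic operation of `U`. The variable `0` is a dummy, which
allows for constants. -/
abbrev Assignment (U V : Variety.{u}) : Type u :=
  ∀ n : ℕ, U.lang.Functions n → V.lang.Term (Fin (n + 1))

section Reduct

variable {U V : Variety.{u}} (τ : Assignment U V)

/-- The algebra in the similarity type of `U` obtained from an algebra in the similarity type of
`V` by means of an assignment, where `a` is the value of the dummy variable. -/
abbrev reduct {A : Type u} [V.lang.Structure A] (a : A) : U.lang.Structure A where
  funMap f x := (τ _ f).realize (Fin.cons a x : Fin (_ + 1) → A)
  RelMap r _ := (U.isAlgebraic _).elim r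

/-- The assignment turns models of `V` into models of `U`. -/
structure IsInterpreting : Prop where
  indep : ∀ (A : Type u) [Nonempty A] [V.lang.Structure A], V.Models A → ∀ n
    (f : U.lang.Functions n) (a b : A) (x : Fin n → A),
    (τ n f).realize (Fin.cons a x : Fin (n + 1) → A) =
      (τ n f).realize (Fin.cons b x : Fin (n + 1) → A)
  models : ∀ (A : Type u) [Nonempty A] [V.lang.Structure A], V.Models A → ∀ a : A,
    letI := reduct τ a
    U.Models A

/-- The translation of terms along an assignment. -/
def translate {α : Type*} (a : α) : U.lang.Term α → V.lang.Term α
  | .var i => .var i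
  | .func f ts => (τ _ f).subst (Fin.cons (.var a) fun i => translate a (ts i))

theorem realize_translate {α : Type*} (a : α) {A : Type u} [V.lang.Structure A]
    (t : U.lang.Term α) (v : α → A) :
    (translate τ a t).realize v = (letI := reduct τ (v a); t.realize v) := by
  induction t with
  | var i => rfl
  | func f ts ih =>
    rw [translate, Term.realize_subst]
    refine congrArg (fun w => (τ _ f).realize w) (funext fun i => ?_)
    refine Fin.cases rfl (fun i => ?_) i
    exact ih i

variable {τ}

/-- Substitution changes the value of the dummy variable of a translated term; this makes the change
harmless. -/
theorem IsInterpreting.reduct_eq (h : IsInterpreting τ) {A : Type u} [Nonempty A]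
    [V.lang.Structure A] (hA : V.Models A) (a b : A) : reduct τ a = reduct τ b := by
  refine Structure.ext ?_ ?_
  · funext n f x
    exact h.indep A hA n f a b x
  · funext n r
    exact (U.isAlgebraic _).elim r

theorem IsInterpreting.valid_translate (h : IsInterpreting τ) {α : Type} (a : α)
    {s t : U.lang.Term α} (hst : U.Valid s t) : V.Valid (translate τ a s) (translate τ a t) := by
  intro A _ _ hA v
  rw [realize_translate, realize_translate]
  let _ := reduct τ (v a)
  exact hst A (h.models A hA (v a)) v

theorem IsInterpreting.le (h : IsInterpreting τ) : U ≤ V := by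
  -- Positive arity supplies the variable `0` that serves as the dummy.
  have hz (n : ℕ+) : NeZero (n : ℕ) := ⟨n.2.ne'⟩
  refine ⟨⟨fun n => Quotient.map (sa := U.termSetoid n) (sb := V.termSetoid n)
    (translate τ (0 : Fin n)) fun s t hst => h.valid_translate 0 hst, fun n i => rfl, ?_⟩⟩
  intro n m f g
  obtain ⟨s, rfl⟩ := Quotient.exists_rep f
  obtain ⟨r, rfl⟩ : ∃ r : Fin n → U.lang.Term (Fin m),
      g = fun i => Quotient.mk (U.termSetoid m) (r i) :=
    ⟨fun i => (g i).out, funext fun i => (Quotient.out_eq _).symm⟩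
  rw [cloneComp_mk]
  refine Eq.trans ?_ (cloneComp_mk V _ _).symm
  refine Quotient.sound (s := V.termSetoid m) fun A _ _ hA v => ?_
  refine (realize_translate τ _ (s.subst r) v).trans ?_
  refine (@Term.realize_subst _ A (reduct τ _) _ _ s r v).trans ?_
  rw [Term.realize_subst]
  refine Eq.trans ?_ (realize_translate τ _ s _).symm
  simp only [realize_translate]
  exact congrArg (fun S => @Term.realize _ A S _ _ s) (h.reduct_eq hA _ _)

end Reduct

/-- The terms are representatives of the images of the basic operations, with an unused variable
prepended to reach positive arity. Compatibility with composition then determines the image of every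
term. -/
theorem exists_isInterpreting {U V : Variety.{u}} (h : U ≤ V) :
    ∃ τ : Assignment U V, IsInterpreting τ := by
  obtain ⟨φ⟩ := h
  let ψ : ∀ n : ℕ, U.lang.Term (Fin (n + 1)) → V.lang.Term (Fin (n + 1)) := fun n t =>
    Quotient.out (φ.toFun n.succPNat (Quotient.mk (U.termSetoid (n + 1)) t))
  have mk_ψ (n) (t : U.lang.Term (Fin (n + 1))) : Quotient.mk (V.termSetoid (n + 1)) (ψ n t) =
      φ.toFun n.succPNat (Quotient.mk (U.termSetoid (n + 1)) t) := Quotient.out_eq _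
  have ψ_congr (n) {s t : U.lang.Term (Fin (n + 1))} (hst : U.Valid s t) :
      V.Valid (ψ n s) (ψ n t) := by
    have : Quotient.mk (U.termSetoid (n + 1)) s = Quotient.mk (U.termSetoid (n + 1)) t :=
      Quotient.sound hst
    simp only [ψ, this]
    exact fun A _ _ _ _ => rfl
  have ψ_var (n) (i : Fin (n + 1)) : V.Valid (ψ n (.var i)) (.var i) := by
    refine Quotient.exact (s := V.termSetoid (n + 1)) ?_
    rw [mk_ψ]
    exact φ.map_proj n.succPNat i
  have ψ_subst (n m) (t : U.lang.Term (Fin (n + 1))) (r : Fin (n + 1) → U.lang.Term (Fin (m + 1))) :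
      V.Valid (ψ m (t.subst r)) ((ψ n t).subst fun i => ψ m (r i)) := by
    refine Quotient.exact (s := V.termSetoid (m + 1)) ?_
    rw [mk_ψ, ← cloneComp_mk, ← cloneComp_mk]
    simp only [mk_ψ]
    exact φ.map_comp n.succPNat m.succPNat _ _
  let base : ∀ n, U.lang.Functions n → U.lang.Term (Fin (n + 1)) := fun n f =>
    .func f fun i => .var i.succ
  let τ : Assignment U V := fun n f => ψ n (base n f)
  have indep : ∀ (A : Type u) [Nonempty A] [V.lang.Structure A], V.Models A → ∀ n
      (f : U.lang.Functions n) (a b : A) (x : Fin n → A),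
      (τ n f).realize (Fin.cons a x : Fin (n + 1) → A) =
        (τ n f).realize (Fin.cons b x : Fin (n + 1) → A) := by
    intro A _ _ hA n f a b x
    -- The left side does not mention `j`: the term `base n f` omits its variable `0`, so
    -- substituting any variable there gives the same term. Taking `j = 0` and `j = 1` compares the
    -- dummy values `a` and `b`.
    have key (j : Fin (n + 2)) :
        (ψ (n + 1) (.func f fun i => .var i.succ.succ)).realize
            (Fin.cons a (Fin.cons b x : Fin (n + 1) → A) : Fin (n + 2) → A) =
          (τ n f).realize (Fin.cons ((Fin.cons a (Fin.cons b x : Fin (n + 1) → A) :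
            Fin (n + 2) → A) j) x : Fin (n + 1) → A) := by
      have := ψ_subst n (n + 1) (base n f) (Fin.cons (.var j) fun i => .var i.succ.succ) A hA
        (Fin.cons a (Fin.cons b x : Fin (n + 1) → A) : Fin (n + 2) → A)
      refine this.trans ?_
      rw [Term.realize_subst]
      refine congrArg (fun w => (τ n f).realize w) (funext fun i => ?_)
      refine Fin.cases ?_ (fun i => ?_) i
      · exact ψ_var (n + 1) j A hA _
      · exact ψ_var (n + 1) i.succ.succ A hA _
    exact (key 0).symm.trans (key 1)
  have realize_ψ (A : Type u) [Nonempty A] [V.lang.Structure A] (hA : V.Models A) (a : A) (m)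
      (t : U.lang.Term (Fin (m + 1))) (v : Fin (m + 1) → A) :
      (letI := reduct τ a; t.realize v) = (ψ m t).realize v := by
    induction t with
    | var i => exact (ψ_var m i A hA v).symm
    | func f ts ih =>
      have := ψ_subst _ m (base _ f) (Fin.cons (.var 0) ts) A hA v
      refine Eq.trans ?_ this.symm
      rw [Term.realize_subst]
      refine (congrArg (fun x : Fin _ → A => (τ _ f).realize (Fin.cons a x : Fin (_ + 1) → A))
        (funext ih)).trans ((indep A hA _ f a (v 0) _).trans ?_)
      refine congrArg (fun w => (τ _ f).realize w) (funext fun i => ?_)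
      refine Fin.cases ?_ (fun i => ?_) i
      · exact (ψ_var m 0 A hA _).symm
      · rfl
  refine ⟨τ, indep, fun A _ _ hA a => ?_⟩
  let _ := reduct τ a
  intro e he v
  obtain ⟨Y₁, h₁⟩ := exists_finset_support e.1
  obtain ⟨Y₂, h₂⟩ := exists_finset_support e.2
  obtain ⟨M, hM⟩ := (Y₁ ∪ Y₂).exists_le
  -- Truncation at `M` fixes every variable that matters for the identity, which thereby becomes a
  -- relation between elements of a clone of positive arity.
  let ρ : ℕ → Fin (M + 1) := fun r => ⟨min r M, by omega⟩
  have hρ : ∀ i ∈ Y₁ ∪ Y₂, v i = v (ρ i) := fun i hi => by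
    simp only [ρ]
    rw [min_eq_left (hM i hi)]
  rw [h₁ A v (fun i => v (ρ i)) fun i hi => hρ i (Finset.mem_union_left _ hi),
    h₂ A v (fun i => v (ρ i)) fun i hi => hρ i (Finset.mem_union_right _ hi)]
  have e₁ := realize_ψ A hA a M (e.1.relabel ρ) (fun i => v i)
  have e₂ := realize_ψ A hA a M (e.2.relabel ρ) (fun i => v i)
  rw [Term.realize_relabel] at e₁ e₂
  refine e₁.trans (Eq.trans ?_ e₂.symm)
  refine ψ_congr M ?_ A hA _
  intro B _ _ hB w
  rw [Term.realize_relabel, Term.realize_relabel]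
  exact hB e he _

/-- A map of similarity types which turns models into models is an interpretation. -/
theorem le_of_lhom {U V : Variety.{u}} (φ : ∀ n, U.lang.Functions n → V.lang.Functions n)
    (h : ∀ (A : Type u) [Nonempty A] [V.lang.Structure A], V.Models A →
      letI := mapStructure U.isAlgebraic φ A
      U.Models A) : U ≤ V := by
  refine IsInterpreting.le (τ := fun n f => .func (φ n f) fun i => .var i.succ) ⟨?_, ?_⟩
  · intros; rfl
  · intro A _ _ hA a
    exact h A hA

/-- The variety of sets. -/
def sets : Variety.{u} where
  lang := ⟨fun _ => PEmpty, fun _ => Empty⟩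
  isAlgebraic := fun _ => inferInstanceAs (IsEmpty Empty)
  eqns := ∅

theorem sets_le (V : Variety.{u}) : sets ≤ V :=
  le_of_lhom (fun _ f => nomatch f) fun _ _ _ _ _ he => absurd he (Set.notMem_empty _)

end Variety

namespace Variety

theorem interpClass_le_interpClass {U V : Variety.{u}} :
    U.interpClass ≤ V.interpClass ↔ U ≤ V :=
  toAntisymmetrization_le_toAntisymmetrization_iff

theorem exists_interpClass_eq (c : InterpClass.{u}) : ∃ V : Variety.{u}, V.interpClass = c :=
  Quotient.exists_rep c

/-! ### Joins -/

/-- The disjoint union of a family of similarity types. -/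
abbrev sumLang {ι : Type u} (U : ι → Variety.{u}) : FirstOrder.Language.{u, 0} :=
  ⟨fun n => Σ i, (U i).lang.Functions n, fun _ => Empty⟩

/-- The join of a family of varieties: the disjoint union of the similarity types and of the
identities. -/
def iJoin {ι : Type u} (U : ι → Variety.{u}) : Variety.{u} where
  lang := sumLang U
  isAlgebraic := fun _ => inferInstanceAs (IsEmpty Empty)
  eqns := ⋃ i, (fun e => (mapTerm (L' := sumLang U) (fun _ f => ⟨i, f⟩) e.1,
    mapTerm (L' := sumLang U) (fun _ f => ⟨i, f⟩) e.2)) '' (U i).eqns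

/-- The inclusion of a similarity type into the similarity type of a join. -/
abbrev incl {ι : Type u} (U : ι → Variety.{u}) (i : ι) (n : ℕ) (f : (U i).lang.Functions n) :
    (iJoin U).lang.Functions n := (⟨i, f⟩ : Σ i, (U i).lang.Functions n)

section iJoin

variable {ι : Type u} (U : ι → Variety.{u})

/-- The algebra satisfies the identities of a member of the family. -/
def ModelsAt (i : ι) (A : Type u) [(iJoin U).lang.Structure A] : Prop :=
  letI := mapStructure (U i).isAlgebraic (incl U i) A
  (U i).Models A

variable {U}

theorem models_iJoin {A : Type u} [(iJoin U).lang.Structure A] :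
    (iJoin U).Models A ↔ ∀ i, ModelsAt U i A := by
  constructor
  · intro h i e he v
    have := h _ (Set.mem_iUnion.2 ⟨i, Set.mem_image_of_mem _ he⟩) v
    exact (realize_mapTerm (U i).isAlgebraic (incl U i) e.1 v).symm.trans
      (this.trans (realize_mapTerm (U i).isAlgebraic (incl U i) e.2 v))
  · intro h e he v
    obtain ⟨i, e', he', rfl⟩ := Set.mem_iUnion.1 he
    exact (realize_mapTerm (U i).isAlgebraic (incl U i) e'.1 v).trans
      ((h i e' he' v).trans (realize_mapTerm (U i).isAlgebraic (incl U i) e'.2 v).symm)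

theorem le_iJoin (i : ι) : U i ≤ iJoin U :=
  le_of_lhom (incl U i) fun _ _ _ hA => models_iJoin.1 hA i

theorem iJoin_le {W : Variety.{u}} (h : ∀ i, U i ≤ W) : iJoin U ≤ W := by
  choose τ hτ using fun i => exists_isInterpreting (h i)
  refine IsInterpreting.le (τ := fun n f => τ f.1 n f.2)
    ⟨fun A _ _ hA n f => (hτ f.1).indep A hA n f.2, fun A _ _ hA a => ?_⟩
  let _ := reduct (U := iJoin U) (fun n f => τ f.1 n f.2) a
  exact models_iJoin.2 fun i => (hτ i).models A hA a

theorem isLUB_iJoin :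
    IsLUB (Set.range fun i => (U i).interpClass) (iJoin U).interpClass := by
  constructor
  · rintro _ ⟨i, rfl⟩
    exact interpClass_le_interpClass.2 (le_iJoin i)
  · intro c hc
    obtain ⟨W, rfl⟩ := exists_interpClass_eq c
    exact interpClass_le_interpClass.2 (iJoin_le fun i =>
      interpClass_le_interpClass.1 (hc ⟨i, rfl⟩))

theorem IsIdempotent.iJoin (h : ∀ i, (U i).IsIdempotent) : (iJoin U).IsIdempotent := by
  rintro n ⟨i, f⟩ A _ _ hA v
  let _ := mapStructure (U i).isAlgebraic (incl U i) A
  exact h i n f A (models_iJoin.1 hA i) v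

theorem IsFinitelyPresented.iJoin [Finite ι] (h : ∀ i, (U i).IsFinitelyPresented) :
    (iJoin U).IsFinitelyPresented := by
  constructor
  · have := fun i => (h i).1
    refine Finite.of_injective (β := Σ i, Σ n, (U i).lang.Functions n)
      (fun f => ⟨f.2.1, f.1, f.2.2⟩) ?_
    rintro ⟨n, i, f⟩ ⟨m, j, g⟩ hfg
    simp only [Sigma.mk.injEq] at hfg
    obtain ⟨rfl, hfg⟩ := hfg
    obtain ⟨rfl, hfg⟩ := Sigma.mk.inj_iff.1 (eq_of_heq hfg)
    rw [eq_of_heq hfg]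
  · exact Set.finite_iUnion fun i => (h i).2.image _

/-! ### Compactness -/

/-- Equality that follows from the identities of finitely many members is a congruence of the term
algebra, and the quotient is a model of the whole join. Evaluating `s` and `t` there at the classes
of the variables gives the finite set. -/
theorem exists_finset_of_valid {α : Type} {s t : (iJoin U).lang.Term α}
    (h : (iJoin U).Valid s t) : ∃ I : Finset ι, ∀ (A : Type u) [Nonempty A]
      [(iJoin U).lang.Structure A], (∀ i ∈ I, ModelsAt U i A) →
        ∀ v : α → A, s.realize v = t.realize v := by
  classical
  let _ := termStructure (iJoin U).lang (iJoin U).isAlgebraic α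
  let θ : Congruence (iJoin U).lang ((iJoin U).lang.Term α) :=
    { r s t := ∃ I : Finset ι, ∀ (A : Type u) [Nonempty A]
        [(iJoin U).lang.Structure A], (∀ i ∈ I, ModelsAt U i A) →
          ∀ v : α → A, s.realize v = t.realize v
      iseqv :=
        { refl s := ⟨∅, fun A _ _ _ _ => rfl⟩
          symm := fun ⟨I, h⟩ => ⟨I, fun A _ _ hA v => (h A hA v).symm⟩
          trans := fun ⟨I, h⟩ ⟨K, k⟩ => ⟨I ∪ K, fun A _ _ hA v =>
            (h A (fun i hi => hA i (Finset.mem_union_left _ hi)) v).trans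
              (k A (fun i hi => hA i (Finset.mem_union_right _ hi)) v)⟩ }
      compatible := by
        intro n f x y hxy
        choose I hI using hxy
        refine ⟨Finset.univ.biUnion I, fun A _ _ hA v => ?_⟩
        refine congrArg (Structure.funMap f) (funext fun j => ?_)
        exact hI j A (fun i hi => hA i (Finset.mem_biUnion.2 ⟨j, Finset.mem_univ _, hi⟩)) v }
  let _ := θ.quotientStructure (iJoin U).isAlgebraic
  have realize_mk {β : Type} (t : (iJoin U).lang.Term β) (v : β → (iJoin U).lang.Term α) :
      (t.realize fun i => Quotient.mk θ.toSetoid (v i)) = Quotient.mk θ.toSetoid (t.subst v) := by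
    rw [← realize_termStructure (iJoin U).isAlgebraic t v]
    exact θ.realize_quotientStructure _ t v
  have : Nonempty (Quotient θ.toSetoid) := ⟨Quotient.mk _ s⟩
  have hmod : (iJoin U).Models (Quotient θ.toSetoid) := by
    refine models_iJoin.2 fun i e he v => ?_
    obtain ⟨r, rfl⟩ : ∃ r : ℕ → (iJoin U).lang.Term α, v = fun i => Quotient.mk θ.toSetoid (r i) :=
      ⟨fun i => (v i).out, funext fun i => (Quotient.out_eq _).symm⟩
    refine (realize_mapTerm (U i).isAlgebraic (incl U i) e.1 _).symm.trans
      (Eq.trans ?_ (realize_mapTerm (U i).isAlgebraic (incl U i) e.2 _))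
    rw [realize_mk, realize_mk]
    refine Quotient.sound ⟨{i}, fun A _ _ hA v => ?_⟩
    rw [Term.realize_subst, Term.realize_subst]
    refine (realize_mapTerm (U i).isAlgebraic (incl U i) e.1 _).trans
      (Eq.trans ?_ (realize_mapTerm (U i).isAlgebraic (incl U i) e.2 _).symm)
    exact hA i (Finset.mem_singleton_self i) e he _
  have key := h _ hmod fun i => Quotient.mk θ.toSetoid (.var i)
  rw [realize_mk, realize_mk] at key
  obtain ⟨I, hI⟩ := Quotient.exact (s := θ.toSetoid) key
  refine ⟨I, fun A _ _ hA v => ?_⟩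
  have := hI A hA v
  rwa [Term.realize_subst, Term.realize_subst] at this

variable (U) in
/-- The inclusion of the similarity type of a finite subjoin. -/
abbrev subIncl (I : Finset ι) (n : ℕ) (f : (Variety.iJoin fun i : I => U i).lang.Functions n) :
    (Variety.iJoin U).lang.Functions n := ⟨f.1, f.2⟩

/-- The statement covers all larger sets so that finitely many terms can share one `K`. -/
theorem exists_finset_mapTerm_eq {α : Type*} (t : (Variety.iJoin U).lang.Term α) :
    ∃ I : Finset ι, ∀ K : Finset ι, I ⊆ K →
      ∃ s : (Variety.iJoin fun i : K => U i).lang.Term α, mapTerm (subIncl U K) s = t := by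
  classical
  induction t with
  | var i => exact ⟨∅, fun K _ => ⟨.var i, rfl⟩⟩
  | func f ts ih =>
    choose I hI using ih
    refine ⟨insert f.1 (Finset.univ.biUnion I), fun K hK => ?_⟩
    choose s hs using fun j => hI j K fun i hi => hK (Finset.mem_insert_of_mem
      (Finset.mem_biUnion.2 ⟨j, Finset.mem_univ _, hi⟩))
    exact ⟨.func ⟨⟨f.1, hK (Finset.mem_insert_self _ _)⟩, f.2⟩ s,
      congrArg (Term.func f) (funext hs)⟩

theorem exists_finset_le_iJoin {V : Variety.{u}} (hV : V.IsFinitelyPresented)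
    (h : V ≤ Variety.iJoin U) : ∃ I : Finset ι, V ≤ Variety.iJoin fun i : I => U i := by
  classical
  obtain ⟨τ, hτ⟩ := exists_isInterpreting h
  have := hV.1
  have := hV.2.to_subtype
  have := Fintype.ofFinite (Σ n, V.lang.Functions n)
  have := Fintype.ofFinite V.eqns
  choose I hI using fun f : Σ n, V.lang.Functions n => exists_finset_mapTerm_eq (τ f.1 f.2)
  -- Independence of the dummy is written as an identity with two candidate dummies, so that
  -- compactness applies to it.
  let g (n : ℕ) (j : Fin (n + 2)) : Fin (n + 1) → Fin (n + 2) :=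
    Fin.cons j fun i => i.succ.succ
  have hg {A : Type u} (n : ℕ) (a b : A) (x : Fin n → A) (j : Fin (n + 2)) :
      (Fin.cons a (Fin.cons b x : Fin (n + 1) → A) : Fin (n + 2) → A) ∘ g n j =
        Fin.cons ((Fin.cons a (Fin.cons b x : Fin (n + 1) → A) : Fin (n + 2) → A) j) x := by
    funext i
    refine Fin.cases rfl (fun i => rfl) i
  have indep (f : Σ n, V.lang.Functions n) :
      (Variety.iJoin U).Valid ((τ f.1 f.2).relabel (g f.1 0)) ((τ f.1 f.2).relabel (g f.1 1)) := by
    intro A _ _ hA v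
    rw [Term.realize_relabel, Term.realize_relabel]
    obtain ⟨a, b, x, rfl⟩ : ∃ a b x, v = Fin.cons a (Fin.cons b x : Fin (f.1 + 1) → A) :=
      ⟨v 0, v 1, fun i => v i.succ.succ, funext fun i => by
        refine Fin.cases rfl (fun i => Fin.cases rfl (fun i => rfl) i) i⟩
    rw [hg, hg]
    exact hτ.indep A hA f.1 f.2 _ _ x
  choose I' hI' using fun f => exists_finset_of_valid (indep f)
  have eqn (e : V.eqns) :
      (Variety.iJoin U).Valid (translate τ (0 : ℕ) e.1.1) (translate τ (0 : ℕ) e.1.2) :=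
    hτ.valid_translate 0 fun A _ _ hA v => hA e.1 e.2 v
  choose I'' hI'' using fun e => exists_finset_of_valid (eqn e)
  -- `K` covers the symbols of the interpreting terms, the independence of the dummies, and the
  -- identities of `V`.
  let K := Finset.univ.biUnion I ∪ Finset.univ.biUnion I' ∪ Finset.univ.biUnion I''
  have hIK (f) : I f ⊆ K := fun i hi => by
    simp only [K, Finset.mem_union, Finset.mem_biUnion, Finset.mem_univ, true_and]
    exact Or.inl (Or.inl ⟨f, hi⟩)
  have hIK' (f) : I' f ⊆ K := fun i hi => by
    simp only [K, Finset.mem_union, Finset.mem_biUnion, Finset.mem_univ, true_and]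
    exact Or.inl (Or.inr ⟨f, hi⟩)
  have hIK'' (f) : I'' f ⊆ K := fun i hi => by
    simp only [K, Finset.mem_union, Finset.mem_biUnion, Finset.mem_univ, true_and]
    exact Or.inr ⟨f, hi⟩
  choose σ hσ using fun f => hI f K (hIK f)
  refine ⟨K, IsInterpreting.le (τ := fun n f => σ ⟨n, f⟩) ?_⟩
  -- Interpret the remaining symbols by a constant.
  let expand (A : Type u) (a : A) [(Variety.iJoin fun i : K => U i).lang.Structure A] :
      (Variety.iJoin U).lang.Structure A :=
    { funMap f x := if h : f.1 ∈ K then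
        Structure.funMap (L := (Variety.iJoin fun i : K => U i).lang) ⟨⟨f.1, h⟩, f.2⟩ x else a
      RelMap r _ := r.elim }
  have map_expand (A : Type u) (a : A) [S : (Variety.iJoin fun i : K => U i).lang.Structure A] :
      (letI := expand A a; mapStructure (Variety.iJoin fun i : K => U i).isAlgebraic
        (subIncl U K) A) = S := by
    refine Structure.ext ?_ ?_
    · funext n f x
      exact dif_pos f.1.2
    · funext n r
      exact r.elim
  have realize_expand (A : Type u) (a : A) [S : (Variety.iJoin fun i : K => U i).lang.Structure A]
      (f : Σ n, V.lang.Functions n) (v : Fin (f.1 + 1) → A) :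
      (letI := expand A a; (τ f.1 f.2).realize v) = (σ f).realize v := by
    rw [← hσ f]
    let _ := expand A a
    refine (realize_mapTerm (Variety.iJoin fun i : K => U i).isAlgebraic (subIncl U K)
      (σ f) v).trans ?_
    exact congrArg (fun S => @Term.realize _ A S _ v (σ f)) (map_expand A a)
  have models_expand (A : Type u) (a : A)
      [S : (Variety.iJoin fun i : K => U i).lang.Structure A]
      (hA : (Variety.iJoin fun i : K => U i).Models A) (i) (hi : i ∈ K) :
      (letI := expand A a; ModelsAt U i A) := by
    have := models_iJoin.1 hA ⟨i, hi⟩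
    rw [← map_expand A a] at this
    exact this
  have indep_expand : ∀ (A : Type u) [Nonempty A]
      [(Variety.iJoin fun i : K => U i).lang.Structure A],
      (Variety.iJoin fun i : K => U i).Models A → ∀ n (f : V.lang.Functions n) (a b : A)
        (x : Fin n → A), (σ ⟨n, f⟩).realize (Fin.cons a x : Fin (n + 1) → A) =
          (σ ⟨n, f⟩).realize (Fin.cons b x : Fin (n + 1) → A) := by
    intro A _ S hA n f a b x
    rw [← realize_expand A a ⟨n, f⟩, ← realize_expand A a ⟨n, f⟩]
    let _ := expand A a
    have := hI' ⟨n, f⟩ A (fun i hi => models_expand A a hA i (hIK' _ hi))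
      (Fin.cons a (Fin.cons b x : Fin (n + 1) → A) : Fin (n + 2) → A)
    rw [Term.realize_relabel, Term.realize_relabel, hg, hg] at this
    exact this
  refine ⟨indep_expand, fun A _ S hA a e he v => ?_⟩
  have reduct_eq : reduct (U := V) (fun n f => σ ⟨n, f⟩) a =
      (letI := expand A a; reduct τ (v 0)) := by
    refine Structure.ext ?_ ?_
    · funext n f x
      exact (indep_expand A hA n f a (v 0) x).trans (realize_expand A a ⟨n, f⟩ _).symm
    · funext n r
      exact (V.isAlgebraic _).elim r
  rw [reduct_eq]
  let _ := expand A a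
  have := hI'' ⟨e, he⟩ A (fun i hi => models_expand A a hA i (hIK'' _ hi)) v
  exact (realize_translate τ 0 e.1 v).symm.trans (this.trans (realize_translate τ 0 e.2 v))

end iJoin

/-! ### Smallness -/

/-- The similarity type with a given number of operation symbols in each arity. -/
abbrev standardLang (k : ℕ → ℕ) : FirstOrder.Language.{u, 0} :=
  ⟨fun n => ULift (Fin (k n)), fun _ => Empty⟩

/-- Renaming symbols does not change the interpretability class. Finitely presentable classes are
therefore represented over a set of similarity types, although all classes together form a proper
class. -/
theorem exists_standardLang (V : Variety.{u}) (hV : V.IsFinitelyPresented) :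
    ∃ (k : ℕ → ℕ) (E : Set ((standardLang.{u} k).Term ℕ × (standardLang.{u} k).Term ℕ)),
      (Variety.mk (standardLang k) (fun _ => inferInstanceAs (IsEmpty Empty)) E).interpClass =
        V.interpClass := by
  have := hV.1
  have (n : ℕ) : Finite (V.lang.Functions n) :=
    Finite.of_injective (fun f => (⟨n, f⟩ : Σ n, V.lang.Functions n)) sigma_mk_injective
  let k (n : ℕ) := Nat.card (V.lang.Functions n)
  let ε (n : ℕ) : (standardLang.{u} k).Functions n ≃ V.lang.Functions n :=
    Equiv.ulift.trans (Finite.equivFin (V.lang.Functions n)).symm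
  let φ (n : ℕ) := ⇑(ε n)
  let ψ (n : ℕ) := ⇑(ε n).symm
  have hφψ (t : V.lang.Term ℕ) : mapTerm φ (mapTerm ψ t) = t := by
    induction t with
    | var i => rfl
    | func f ts ih =>
      simp only [mapTerm, ih]
      exact congrArg (fun g => Term.func g ts) ((ε _).apply_symm_apply f)
  have hψ (n) (f) : φ n (ψ n f) = f := (ε n).apply_symm_apply f
  have hφ (n) (f) : ψ n (φ n f) = f := (ε n).symm_apply_apply f
  let W : Variety.{u} := Variety.mk (standardLang k) (fun _ => inferInstanceAs (IsEmpty Empty))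
    {e | (mapTerm φ e.1, mapTerm φ e.2) ∈ V.eqns}
  refine ⟨k, {e | (mapTerm φ e.1, mapTerm φ e.2) ∈ V.eqns}, ?_⟩
  refine le_antisymm (interpClass_le_interpClass.2 ?_) (interpClass_le_interpClass.2 ?_)
  · refine le_of_lhom φ fun A _ _ hA e he v => ?_
    exact (realize_mapTerm W.isAlgebraic φ e.1 v).symm.trans
      ((hA _ he v).trans (realize_mapTerm W.isAlgebraic φ e.2 v))
  · refine le_of_lhom (V := W) ψ fun A _ _ hA e he v => ?_
    have he' : (mapTerm ψ e.1, mapTerm ψ e.2) ∈ W.eqns := by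
      change (mapTerm φ (mapTerm ψ e.1), mapTerm φ (mapTerm ψ e.2)) ∈ V.eqns
      rwa [hφψ, hφψ]
    exact (realize_mapTerm V.isAlgebraic ψ e.1 v).symm.trans
      ((hA _ he' v).trans (realize_mapTerm V.isAlgebraic ψ e.2 v))

end Variety

/-- Joins are formed over index types in `Type u`, whereas sets of classes live one universe higher;
smallness bridges the gap. -/
instance small_idempotentFinPres : Small.{u} idempotentFinPres.{u} := by
  let code : (Σ k : ℕ → ℕ, Set ((Variety.standardLang.{u} k).Term ℕ ×
      (Variety.standardLang.{u} k).Term ℕ)) → InterpClass.{u} := fun c =>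
    (Variety.mk (Variety.standardLang c.1) (fun _ => inferInstanceAs (IsEmpty Empty))
      c.2).interpClass
  refine small_subset.{u, u + 1} (s := Set.range code) ?_
  rintro _ ⟨V, -, hV, rfl⟩
  obtain ⟨k, E, h⟩ := V.exists_standardLang hV
  exact ⟨⟨k, E⟩, h⟩

/-- Every subset of the collection of idempotent, finitely presentable classes is represented by
a family of varieties indexed by a type in the universe of the similarity types. -/
theorem exists_family {S : Set InterpClass.{u}} (hS : S ⊆ idempotentFinPres) :
    ∃ (ι : Type u) (U : ι → Variety.{u}), (∀ i, (U i).IsIdempotent) ∧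
      (∀ i, (U i).IsFinitelyPresented) ∧ (Function.Injective fun i => (U i).interpClass) ∧
      (Set.range fun i => (U i).interpClass) = S := by
  have : Small.{u} S := small_subset.{u, u + 1} hS
  -- One index per class makes the family injective, so a finite set of classes has a finite index
  -- type.
  choose U h₁ h₂ h₃ using fun i : Shrink.{u} S => hS ((equivShrink S).symm i).2
  refine ⟨Shrink.{u} S, U, h₁, h₂, ?_, ?_⟩
  · intro i j hij
    simp only [h₃] at hij
    exact (equivShrink S).symm.injective (Subtype.ext hij)
  ext c
  constructor
  · rintro ⟨i, rfl⟩
    change (U i).interpClass ∈ S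
    rw [h₃ i]
    exact Subtype.coe_prop _
  · intro hc
    refine ⟨equivShrink S ⟨c, hc⟩, ?_⟩
    change (U _).interpClass = c
    rw [h₃, Equiv.symm_apply_apply]

theorem exists_isLUB {S : Set InterpClass.{u}} (hS : S ⊆ idempotentFinPres) : ∃ j, IsLUB S j := by
  obtain ⟨ι, U, -, -, -, rfl⟩ := exists_family hS
  exact ⟨_, Variety.isLUB_iJoin⟩

theorem mem_idempotentFinPres_of_isLUB {S : Set InterpClass.{u}} (hS : S ⊆ idempotentFinPres)
    (hfin : S.Finite) {j : InterpClass.{u}} (hj : IsLUB S j) : j ∈ idempotentFinPres := by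
  obtain ⟨ι, U, h₁, h₂, hinj, rfl⟩ := exists_family hS
  have : Finite ι := by
    rw [← Set.finite_univ_iff]
    refine Set.Finite.of_finite_image ?_ hinj.injOn
    rwa [Set.image_univ]
  exact ⟨Variety.iJoin U, Variety.IsIdempotent.iJoin h₁, Variety.IsFinitelyPresented.iJoin h₂,
    Variety.isLUB_iJoin.unique hj⟩

/-! ### Principal filters -/

/-- Lying above a member of `idempotentFinPres` is preserved by the coarser order as well.
Compactness is `exists_finset_le_iJoin`. -/
theorem isIdempotentMalcevFilter_Ici {U : Variety.{u}} (h₁ : U.IsIdempotent)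
    (h₂ : U.IsFinitelyPresented) : IsIdempotentMalcevFilter (Set.Ici U.interpClass) := by
  have hU : U.interpClass ∈ idempotentFinPres := ⟨U, h₁, h₂, rfl⟩
  have hF : U.interpClass ∈ Set.Ici U.interpClass := Set.self_mem_Ici
  refine ⟨⟨⟨⟨_, hF⟩, fun x hx y hxy => Set.mem_Ici.2 (le_trans (Set.mem_Ici.1 hx) hxy), fun x hx y hy => ⟨_, hF, hx, hy⟩⟩,
    ⟨⟨_, hF⟩, fun x hx y hxy => hxy _ hU hx, fun x hx y hy => ⟨_, hF,
      fun w _ hw => le_trans hw hx, fun w _ hw => le_trans hw hy⟩⟩⟩, ?_⟩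
  intro S hS j hj hUj
  obtain ⟨ι, W, -, -, -, rfl⟩ := exists_family hS
  rw [hj.unique Variety.isLUB_iJoin] at hUj
  obtain ⟨I, hI⟩ := Variety.exists_finset_le_iJoin h₂ (Variety.interpClass_le_interpClass.1 hUj)
  refine ⟨_, ?_, Set.finite_range fun i : I => (W i).interpClass, _, Variety.isLUB_iJoin,
    Variety.interpClass_le_interpClass.2 hI⟩
  rintro _ ⟨i, rfl⟩
  exact ⟨i, rfl⟩

theorem Variety.satisfiesNontrivialIdempotentMalcevCondition_iff {V : Variety.{u}} :
    V.SatisfiesNontrivialIdempotentMalcevCondition ↔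
      ∃ U : Variety.{u}, U.IsIdempotent ∧ U.IsFinitelyPresented ∧ U ≤ V ∧ ¬ U ≤ Variety.sets := by
  constructor
  · rintro ⟨F, ⟨⟨hF, hF'⟩, hcomp⟩, hne, hV⟩
    let S : Set InterpClass.{u} := {w | w ∈ idempotentFinPres ∧ w ≤ V.interpClass}
    have hS : S ⊆ idempotentFinPres := fun w hw => hw.1
    obtain ⟨j, hj⟩ := exists_isLUB hS
    -- Although `j ≤ V`, the class of `V` lies below `j` in the coarser order, since `j` bounds
    -- every member of `S`.
    have hjF : j ∈ F := hF'.up_closed _ hV j fun w hw hwV => hj.1 ⟨hw, hwV⟩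
    obtain ⟨S₀, hS₀, hfin, j₀, hj₀, hjF₀⟩ := hcomp S hS j hj hjF
    obtain ⟨U, h₁, h₂, rfl⟩ := mem_idempotentFinPres_of_isLUB (hS₀.trans hS) hfin hj₀
    refine ⟨U, h₁, h₂, interpClass_le_interpClass.1 (hj₀.2 fun w hw => (hS₀ hw).2), fun h => hne ?_⟩
    refine Set.eq_univ_of_forall fun c => ?_
    obtain ⟨W, rfl⟩ := exists_interpClass_eq c
    exact hF.up_closed _ hjF₀ _ (interpClass_le_interpClass.2 (h.trans (sets_le W)))
  · rintro ⟨U, h₁, h₂, hUV, hU⟩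
    refine ⟨_, isIdempotentMalcevFilter_Ici h₁ h₂, fun h => hU ?_,
      interpClass_le_interpClass.2 hUV⟩
    have : sets.interpClass ∈ Set.Ici U.interpClass := h ▸ Set.mem_univ _
    exact interpClass_le_interpClass.1 this

/-! ### Taylor operations -/

/-! ### Merging and iterating idempotent operations -/

section Star

variable {A : Type*} {O : Type*} {ar : O → ℕ}

/-- All operations of a finite family of idempotent operations arise from a single idempotent
operation by identification of variables. -/
theorem exists_star [Finite O] (hP : Nonempty (∀ i, Fin (ar i)))
    (op : ∀ i, (Fin (ar i) → A) → A) (hop : ∀ i a, op i (fun _ => a) = a) :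
    ∃ F : ((∀ i, Fin (ar i)) → A) → A, (∀ a, F (fun _ => a) = a) ∧
      (∀ i x, F (fun p => x (p i)) = op i x) ∧
      ∀ θ : A → A → Prop, (∀ i x y, (∀ j, θ (x j) (y j)) → θ (op i x) (op i y)) →
        ∀ x y, (∀ p, θ (x p) (y p)) → θ (F x) (F y) := by
  classical
  have := Fintype.ofFinite O
  obtain ⟨p₀⟩ := hP
  suffices h : ∀ s : Finset O, ∃ F : ((∀ i, Fin (ar i)) → A) → A, (∀ a, F (fun _ => a) = a) ∧
      (∀ i ∈ s, ∀ x, F (fun p => x (p i)) = op i x) ∧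
      ∀ θ : A → A → Prop, (∀ i x y, (∀ j, θ (x j) (y j)) → θ (op i x) (op i y)) →
        ∀ x y, (∀ p, θ (x p) (y p)) → θ (F x) (F y) by
    obtain ⟨F, h₁, h₂, h₃⟩ := h Finset.univ
    exact ⟨F, h₁, fun i => h₂ i (Finset.mem_univ i), h₃⟩
  intro s
  induction s using Finset.induction_on with
  | empty => exact ⟨fun x => x p₀, fun _ => rfl, by simp, fun θ _ x y h => h p₀⟩
  | insert j s hj ih =>
    obtain ⟨F, h₁, h₂, h₃⟩ := ih
    -- The new operation goes outside, and its `r`-th argument overwrites coordinate `j` by `r`. If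
    -- `x` depends on coordinate `j` only, `F` collapses by idempotence and `op j` remains; if it
    -- depends on another coordinate only, `op j` collapses.
    refine ⟨fun x => op j fun r => F fun p => x (Function.update p j r), fun a => ?_, ?_, ?_⟩
    · simp only [h₁, hop]
    · intro i hi x
      by_cases hij : i = j
      · subst hij
        simp only [Function.update_self, h₁]
      · simp only [Function.update_of_ne hij, h₂ i (Finset.mem_of_mem_insert_of_ne hi hij), hop]
    · exact fun θ hθ x y h => hθ j _ _ fun r => h₃ θ hθ _ _ fun p => h _

/-- The `d`-fold composition of an operation with itself. -/
def iterOp {P : Type*} (F : (P → A) → A) : ∀ d : ℕ, ((Fin d → P) → A) → A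
  | 0, x => x Fin.elim0
  | d + 1, x => F fun p => iterOp F d fun w => x (Fin.cons p w)

variable {P : Type*} {F : (P → A) → A}

theorem iterOp_const (hF : ∀ a, F (fun _ => a) = a) (d : ℕ) (a : A) :
    iterOp F d (fun _ => a) = a := by
  induction d with
  | zero => rfl
  | succ d ih => simp only [iterOp, ih, hF]

theorem iterOp_rel {θ : A → A → Prop} (hF : ∀ x y, (∀ p, θ (x p) (y p)) → θ (F x) (F y)) (d : ℕ)
    (x y : (Fin d → P) → A) (h : ∀ w, θ (x w) (y w)) : θ (iterOp F d x) (iterOp F d y) := by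
  induction d with
  | zero => exact h _
  | succ d ih => exact hF _ _ fun p => ih _ _ fun w => h _

/-- Only layer `k` sees a nonconstant argument; the other layers collapse by idempotence. -/
theorem iterOp_apply (hF : ∀ a, F (fun _ => a) = a) (d : ℕ) (k : Fin d) (x : P → A) :
    iterOp F d (fun w => x (w k)) = F x := by
  induction d with
  | zero => exact k.elim0
  | succ d ih =>
    refine Fin.cases ?_ (fun k => ?_) k
    · simp only [iterOp, Fin.cons_zero, iterOp_const hF]
    · simp only [iterOp, Fin.cons_succ, ih, hF]

end Star

/-! ### Terms as iterates of a single operation -/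

section Projections

variable {L : FirstOrder.Language.{u, 0}}

/-- A choice of a projection for every basic operation. -/
abbrev Projections (L : FirstOrder.Language.{u, 0}) : Type u :=
  ∀ i : Σ n, L.Functions n, Fin i.1

/-- The variable to which a term evaluates when basic operations at depth `k` are interpreted
according to the `k`-th choice of projections. -/
def projEval {α : Type*} : L.Term α → (ℕ → Projections L) → α
  | .var i, _ => i
  | .func f ts, w => projEval (ts (w 0 ⟨_, f⟩)) fun k => w (k + 1)

/-- The depth of a term. -/
def termDepth {α : Type*} : L.Term α → ℕ
  | .var _ => 0
  | .func _ ts => (Finset.univ.sup fun i => termDepth (ts i)) + 1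

theorem termDepth_lt {α : Type*} {n : ℕ} (f : L.Functions n) (ts : Fin n → L.Term α) (i : Fin n) :
    termDepth (ts i) < termDepth (.func f ts) :=
  Nat.lt_succ_of_le (Finset.le_sup (f := fun i => termDepth (ts i)) (Finset.mem_univ i))

theorem projEval_congr {α : Type*} (t : L.Term α) (w w' : ℕ → Projections L)
    (h : ∀ k < termDepth t, w k = w' k) : projEval t w = projEval t w' := by
  induction t generalizing w w' with
  | var i => rfl
  | func f ts ih =>
    rw [projEval, projEval, h 0 (Nat.succ_pos _)]
    exact ih _ _ _ fun k hk => h _ (by have := termDepth_lt f ts (w' 0 ⟨_, f⟩); omega)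

/-- Extension of a finite sequence. -/
def extendSeq {P : Type*} (p₀ : P) {d : ℕ} (w : Fin d → P) (k : ℕ) : P :=
  if h : k < d then w ⟨k, h⟩ else p₀

theorem extendSeq_cons {P : Type*} (p₀ p : P) {d : ℕ} (w : Fin d → P) :
    (extendSeq p₀ (Fin.cons p w : Fin (d + 1) → P) 0 = p) ∧
      ∀ k, extendSeq p₀ (Fin.cons p w : Fin (d + 1) → P) (k + 1) = extendSeq p₀ w k := by
  refine ⟨rfl, fun k => ?_⟩
  by_cases h : k < d
  · rw [extendSeq, extendSeq, dif_pos h, dif_pos (Nat.succ_lt_succ h)]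
    rfl
  · rw [extendSeq, extendSeq, dif_neg h, dif_neg (fun h' => h (Nat.lt_of_succ_lt_succ h'))]

/-- By `h₂` each basic operation is `F` with variables identified, so each level of the term uses
one layer of the iterate. Idempotence absorbs the surplus layers below shallow leaves. The padding
`p₀` is never read, as the depth is at most `d`. -/
theorem realize_eq_iterOp {A : Type*} [L.Structure A] {F : (Projections L → A) → A}
    (h₁ : ∀ a, F (fun _ => a) = a)
    (h₂ : ∀ (i : Σ n, L.Functions n) x, F (fun p => x (p i)) = Structure.funMap i.2 x)
    (p₀ : Projections L) {α : Type*} (t : L.Term α) (v : α → A) (d : ℕ) (hd : termDepth t ≤ d) :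
    iterOp F d (fun w => v (projEval t (extendSeq p₀ w))) = t.realize v := by
  induction t generalizing d with
  | var i => exact iterOp_const h₁ d (v i)
  | func f ts ih =>
    obtain _ | d := d
    · exact absurd hd (Nat.not_succ_le_zero _)
    · rw [Term.realize_func, ← h₂ ⟨_, f⟩, iterOp]
      congr 1
      funext p
      rw [← ih (p ⟨_, f⟩) d (by have := termDepth_lt f ts (p ⟨_, f⟩); omega)]
      congr 1
      funext w
      rw [projEval, (extendSeq_cons p₀ p w).1]
      simp only [(extendSeq_cons p₀ p w).2]

end Projections

/-- The algebra `A` has an idempotent operation preserving the congruences which satisfies the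
identities `T(u_w) ≈ T(v_w)` in two variables. -/
def HasTaylorOp (L : FirstOrder.Language.{u, 0}) (A : Type u) [L.Structure A] {W : Type*}
    (u v : W → W → Prop) : Prop :=
  ∃ T : (W → A) → A, (∀ a, T (fun _ => a) = a) ∧
    (∀ (θ : Congruence L A) x y, (∀ i, θ.r (x i) (y i)) → θ.r (T x) (T y)) ∧
    ∀ w (x y : W → A) (a b : A), (∀ i, u w i → x i = a) → (∀ i, ¬ u w i → x i = b) →
      (∀ i, v w i → y i = a) → (∀ i, ¬ v w i → y i = b) → T x = T y

theorem Variety.le_sets_of_projections {U : Variety.{u}} (p : Projections U.lang)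
    (h : ∀ e ∈ U.eqns, projEval e.1 (fun _ => p) = projEval e.2 (fun _ => p)) :
    U ≤ Variety.sets := by
  refine IsInterpreting.le (τ := fun n f => .var (p ⟨n, f⟩).succ) ⟨fun _ _ _ _ _ _ _ _ _ => rfl, ?_⟩
  intro A _ _ hA a
  let _ := reduct (U := U) (V := Variety.sets) (fun n f => .var (p ⟨n, f⟩).succ) a
  have key {α : Type} (t : U.lang.Term α) (v : α → A) :
      t.realize v = v (projEval t fun _ => p) := by
    induction t with
    | var i => rfl
    | func f ts ih => exact ih _
  intro e he v
  rw [key, key, h e he]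

/-- Coordinates of the iterate are words `w` of choices of projections. A nonconstant word is
excluded because the layers are interchangeable (`iterOp_apply`). A constant word is excluded by an
identity of `U` that its projections violate, which exists since `U` does not interpret into sets.
-/
theorem Variety.exists_hasTaylorOp {U : Variety.{u}} (h₁ : U.IsIdempotent)
    (h₂ : U.IsFinitelyPresented) (h₃ : ¬ U ≤ Variety.sets) :
    ∃ (n : ℕ) (u v : Fin n → Fin n → Prop), (∀ w, u w w ∧ ¬ v w w) ∧
      ∀ (A : Type u) [Nonempty A] [U.lang.Structure A], U.Models A → HasTaylorOp U.lang A u v := by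
  classical
  suffices h : ∃ (W : Type u) (_ : Finite W) (u v : W → W → Prop), (∀ w, u w w ∧ ¬ v w w) ∧
      ∀ (A : Type u) [Nonempty A] [U.lang.Structure A], U.Models A → HasTaylorOp U.lang A u v by
    obtain ⟨W, _, u, v, huv, h⟩ := h
    let ε := Finite.equivFin W
    refine ⟨Nat.card W, fun i j => u (ε.symm i) (ε.symm j), fun i j => v (ε.symm i) (ε.symm j),
      fun w => huv _, fun A _ _ hA => ?_⟩
    obtain ⟨T, hT₁, hT₂, hT₃⟩ := h A hA
    refine ⟨fun x => T (x ∘ ε), hT₁, fun θ x y hxy => hT₂ θ _ _ fun i => hxy _, ?_⟩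
    intro w x y a b hua hub hva hvb
    refine hT₃ (ε.symm w) _ _ a b ?_ ?_ ?_ ?_
    · exact fun i hi => hua _ (by simpa using hi)
    · exact fun i hi => hub _ (by simpa using hi)
    · exact fun i hi => hva _ (by simpa using hi)
    · exact fun i hi => hvb _ (by simpa using hi)
  have idem (A : Type u) [Nonempty A] [U.lang.Structure A] (hA : U.Models A) (n)
      (f : U.lang.Functions n) (a : A) : Structure.funMap f (fun _ => a) = a :=
    h₁ n f A hA fun _ => a
  have := h₂.1
  by_cases hP : Nonempty (Projections U.lang)
  swap
  -- With no choice of projections there is a nullary symbol, and an idempotent constant forces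
  -- one-element models; no identities are then needed.
  · refine ⟨PEmpty, inferInstance, PEmpty.elim, PEmpty.elim, fun w => w.elim, fun A _ _ hA => ?_⟩
    obtain ⟨⟨n, f⟩, hn⟩ : ∃ i : Σ n, U.lang.Functions n, i.1 = 0 := by
      by_contra hne
      push Not at hne
      exact hP ⟨fun i => ⟨0, Nat.pos_of_ne_zero (hne i)⟩⟩
    obtain rfl : n = 0 := hn
    have : Subsingleton A := ⟨fun a b => by
      rw [← idem A hA 0 f a, ← idem A hA 0 f b]
      congr 1
      exact Subsingleton.elim _ _⟩
    exact ⟨fun _ => Classical.arbitrary A, fun a => Subsingleton.elim _ _,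
      fun θ _ _ _ => θ.iseqv.refl _, fun w => w.elim⟩
  obtain ⟨p₀⟩ := hP
  -- The bound `d + 1` guarantees that words have a letter `0`.
  obtain ⟨d, hd⟩ : ∃ d : ℕ, ∀ e ∈ U.eqns, termDepth e.1 ≤ d + 1 ∧ termDepth e.2 ≤ d + 1 := by
    obtain ⟨d, hd⟩ := (h₂.2.image fun e => max (termDepth e.1) (termDepth e.2)).bddAbove
    exact ⟨d, fun e he => max_le_iff.1 ((hd ⟨e, he, rfl⟩).trans (Nat.le_succ d))⟩
  let W := Fin (d + 1) → Projections U.lang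
  let lam (t : U.lang.Term ℕ) (w : W) : ℕ := projEval t (extendSeq p₀ w)
  -- Each projection violates one of the identities.
  have key (w : W) : ∃ u v : W → Prop, u w ∧ ¬ v w ∧
      ((∃ e ∈ U.eqns, u = (fun i => lam e.1 i = lam e.1 w) ∧ v = fun i => lam e.2 i = lam e.1 w) ∨
      ∃ (f : Σ n, U.lang.Functions n) (k : Fin (d + 1)),
        u = (fun i => i 0 f = w 0 f) ∧ v = fun i => i k f = w 0 f) := by
    by_contra hne
    push Not at hne
    have hw (k : Fin (d + 1)) : w k = w 0 := by
      funext f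
      by_contra hk
      exact (hne (fun i => i 0 f = w 0 f) (fun i => i k f = w 0 f) rfl hk).2 f k rfl rfl
    refine h₃ (Variety.le_sets_of_projections (w 0) fun e he => ?_)
    by_contra hk
    have hext (k : ℕ) (hk : k < d + 1) : extendSeq p₀ w k = w 0 := by
      rw [extendSeq, dif_pos hk, hw]
    have h₁ : lam e.1 w = projEval e.1 fun _ => w 0 :=
      projEval_congr _ _ _ fun k hk => hext k (hk.trans_le (hd e he).1)
    have h₂ : lam e.2 w = projEval e.2 fun _ => w 0 :=
      projEval_congr _ _ _ fun k hk => hext k (hk.trans_le (hd e he).2)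
    rw [← h₁, ← h₂] at hk
    exact (hne (fun i => lam e.1 i = lam e.1 w) (fun i => lam e.2 i = lam e.1 w) rfl
      (Ne.symm hk)).1 e he rfl rfl
  choose u v hu hv huv using key
  have : Finite W := inferInstance
  refine ⟨W, this, u, v, fun w => ⟨hu w, hv w⟩, fun A _ _ hA => ?_⟩
  obtain ⟨F, hF₁, hF₂, hF₃⟩ := exists_star (A := A) ⟨p₀⟩
    (fun i : Σ n, U.lang.Functions n => Structure.funMap i.2) fun i => idem A hA i.1 i.2
  refine ⟨iterOp F (d + 1), iterOp_const hF₁ _, fun θ => iterOp_rel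
    (hF₃ θ.r fun i => θ.compatible i.2) _, fun w x y a b hua hub hva hvb => ?_⟩
  obtain ⟨e, he, hu', hv'⟩ | ⟨f, k, hu', hv'⟩ := huv w
  -- Giving `a` to the variable picked by `w` on the left side of `e`, and `b` to all others, turns
  -- `x` and `y` into the argument tuples of the two sides.
  · let z (r : ℕ) : A := if r = lam e.1 w then a else b
    have hx : x = fun i => z (lam e.1 i) := by
      funext i
      rw [hu'] at hua hub
      by_cases hi : lam e.1 i = lam e.1 w
      · exact (hua i hi).trans (if_pos hi).symm
      · exact (hub i hi).trans (if_neg hi).symm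
    have hy : y = fun i => z (lam e.2 i) := by
      funext i
      rw [hv'] at hva hvb
      by_cases hi : lam e.2 i = lam e.1 w
      · exact (hva i hi).trans (if_pos hi).symm
      · exact (hvb i hi).trans (if_neg hi).symm
    rw [hx, hy]
    exact (realize_eq_iterOp hF₁ hF₂ p₀ e.1 z _ (hd e he).1).trans ((hA e he z).trans
      (realize_eq_iterOp hF₁ hF₂ p₀ e.2 z _ (hd e he).2).symm)
  · let z (r : Fin f.1) : A := if r = w 0 f then a else b
    have hx : x = fun i => z (i 0 f) := by
      funext i
      rw [hu'] at hua hub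
      by_cases hi : i 0 f = w 0 f
      · exact (hua i hi).trans (if_pos hi).symm
      · exact (hub i hi).trans (if_neg hi).symm
    have hy : y = fun i => z (i k f) := by
      funext i
      rw [hv'] at hva hvb
      by_cases hi : i k f = w 0 f
      · exact (hva i hi).trans (if_pos hi).symm
      · exact (hvb i hi).trans (if_neg hi).symm
    rw [hx, hy]
    exact (iterOp_apply hF₁ _ 0 fun p => z (p f)).trans
      (iterOp_apply hF₁ _ k fun p => z (p f)).symm

/-- A congruence of `A` is also a congruence of its reduct, so the operation of the reduct serves
for `A`. -/
theorem Variety.hasTaylorOp_of_le {U V : Variety.{u}} (h : U ≤ V) {W : Type*} {u v : W → W → Prop}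
    (hU : ∀ (A : Type u) [Nonempty A] [U.lang.Structure A], U.Models A → HasTaylorOp U.lang A u v)
    (A : Type u) [Nonempty A] [V.lang.Structure A] (hA : V.Models A) :
    HasTaylorOp V.lang A u v := by
  obtain ⟨τ, hτ⟩ := exists_isInterpreting h
  let a := Classical.arbitrary A
  let _ := reduct τ a
  obtain ⟨T, hT₁, hT₂, hT₃⟩ := hU A (hτ.models A hA a)
  refine ⟨T, hT₁, fun θ => ?_, hT₃⟩
  refine hT₂ ⟨θ.toSetoid, fun f x y hxy => θ.realize (τ _ f) fun i => ?_⟩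
  exact Fin.cases (θ.iseqv.refl _) hxy i

/-! ### The congruence equation of a Taylor operation -/

namespace CongTerm

/-- The join of a list of terms and of the variable `1`. -/
def bigJoin (l : List CongTerm) : CongTerm := l.foldr join (var 1)

/-- The meet of a term and of a list of terms. -/
def bigMeet (t : CongTerm) (l : List CongTerm) : CongTerm := l.foldr meet t

section Eval

variable {L : FirstOrder.Language.{u, 0}} {A : Type u} [L.Structure A] {ρ : ℕ → Congruence L A}

theorem eval_bigMeet {t : CongTerm} {l : List CongTerm} {a b : A} :
    (bigMeet t l).eval L ρ a b ↔ t.eval L ρ a b ∧ ∀ s ∈ l, s.eval L ρ a b := by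
  induction l with
  | nil => simp [bigMeet]
  | cons s l ih =>
    change s.eval L ρ a b ∧ (bigMeet t l).eval L ρ a b ↔ _
    rw [ih, List.forall_mem_cons]
    tauto

theorem eval_bigJoin_of_mem {l : List CongTerm} {s : CongTerm} (hs : s ∈ l) {a b : A}
    (h : s.eval L ρ a b) : (bigJoin l).eval L ρ a b := by
  induction l with
  | nil => cases hs
  | cons r l ih =>
    rintro θ h₁ h₂
    obtain rfl | hs := List.mem_cons.1 hs
    · exact h₁ _ _ h
    · exact h₂ _ _ (ih hs)

theorem eval_bigJoin_le {l : List CongTerm} (θ : Congruence L A) (h₁ : ∀ a b, (ρ 1).r a b → θ.r a b)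
    (h : ∀ s ∈ l, ∀ a b, s.eval L ρ a b → θ.r a b) {a b : A} (hab : (bigJoin l).eval L ρ a b) :
    θ.r a b := by
  induction l generalizing a b with
  | nil => exact h₁ _ _ hab
  | cons s l ih =>
    exact hab θ (h s List.mem_cons_self)
      fun x y hxy => ih (fun r hr => h r (List.mem_cons_of_mem _ hr)) hxy

/-- The join of two relations, as a congruence. -/
def joinCong (L : FirstOrder.Language.{u, 0}) {A : Type u} [L.Structure A] (R S : A → A → Prop) :
    Congruence L A where
  r := joinRel L R S
  iseqv := ⟨fun _ θ _ _ => θ.iseqv.refl _, fun h θ h₁ h₂ => θ.iseqv.symm (h θ h₁ h₂),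
    fun h k θ h₁ h₂ => θ.iseqv.trans (h θ h₁ h₂) (k θ h₁ h₂)⟩
  compatible f x y h θ h₁ h₂ := θ.compatible f x y fun i => h i θ h₁ h₂

/-- Terms with `∘` need not denote congruences, but these joins do, and only congruences are known
to be preserved by `T`. -/
theorem exists_eval_bigJoin_eq (L : FirstOrder.Language.{u, 0}) {A : Type u} [L.Structure A]
    (ρ : ℕ → Congruence L A) (l : List CongTerm) :
    ∃ θ : Congruence L A, (bigJoin l).eval L ρ = θ.r := by
  cases l with
  | nil => exact ⟨ρ 1, rfl⟩
  | cons s l => exact ⟨joinCong L (s.eval L ρ) ((bigJoin l).eval L ρ), rfl⟩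

end Eval

variable {n : ℕ}

/-- The `j`-th variable of the first kind. -/
abbrev left (j : Fin n) : CongTerm := var (2 * j + 2)

/-- The `j`-th variable of the second kind. -/
abbrev right (j : Fin n) : CongTerm := var (2 * j + 3)

open Classical in
/-- The join of the left variables in a set and the right variables in the complement. -/
noncomputable def mixed (c : Fin n → Prop) : CongTerm :=
  bigJoin (List.ofFn fun j => if c j then left j else right j)

variable (n) in
/-- The left-hand side of the inclusion defined by the identities of a Taylor operation. -/
def taylorLeft : CongTerm := bigMeet (var 0) (List.ofFn fun j : Fin n => comp (left j) (right j))

/-- The right-hand side of the inclusion defined by the identities of a Taylor operation. -/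
noncomputable def taylorRight (u v : Fin n → Fin n → Prop) : CongTerm :=
  comp (bigMeet (mixed fun _ : Fin n => True)
    (List.ofFn fun i => comp (var 0) (meet (mixed (u i)) (mixed (v i))))) (mixed fun _ : Fin n => False)

end CongTerm

open CongTerm

/-! ### The inclusion holds in the presence of a Taylor operation -/

section Satisfies

variable {L : FirstOrder.Language.{u, 0}} {A : Type u} [L.Structure A]
  {ρ : ℕ → Congruence L A} {n : ℕ}

theorem eval_mixed_of_taylor {T : (Fin n → A) → A}
    (hT : ∀ (θ : Congruence L A) x y, (∀ i, θ.r (x i) (y i)) → θ.r (T x) (T y))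
    (c : Fin n → Prop) (x y : Fin n → A) (h₁ : ∀ i, c i → (ρ (2 * i + 2)).r (x i) (y i))
    (h₂ : ∀ i, ¬ c i → (ρ (2 * i + 3)).r (x i) (y i)) : (mixed c).eval L ρ (T x) (T y) := by
  classical
  have hmem (i : Fin n) : (mixed c).eval L ρ (x i) (y i) := by
    by_cases hi : c i
    · exact eval_bigJoin_of_mem (s := left i) (List.mem_ofFn.2 ⟨i, if_pos hi⟩) (h₁ i hi)
    · exact eval_bigJoin_of_mem (s := right i) (List.mem_ofFn.2 ⟨i, if_neg hi⟩) (h₂ i hi)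
  obtain ⟨θ, hθ⟩ := exists_eval_bigJoin_eq L ρ
    (List.ofFn fun j => if c j then left j else right j)
  change ∀ i, bigJoin _ |>.eval L ρ (x i) (y i) at hmem
  change (bigJoin _).eval L ρ (T x) (T y)
  rw [hθ] at hmem ⊢
  exact hT θ x y hmem

/-- Let `m j` be the midpoint between `a` and `b` in the `j`-th composition. The middle point on the
right side is `T m`: moving all coordinates to `a`, or all to `b`, links it to the ends by
idempotence. For row `i`, move coordinates to `a` where `u i` holds and to `b` elsewhere, and
likewise for `v i`. The identity makes the two results equal, and this common point is related to
`a` by variable `0`. -/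
theorem eval_taylorRight {u v : Fin n → Fin n → Prop} (h : HasTaylorOp L A u v) {a b : A}
    (hab : (taylorLeft n).eval L ρ a b) : (taylorRight u v).eval L ρ a b := by
  classical
  obtain ⟨T, hT₁, hT₂, hT₃⟩ := h
  obtain ⟨h₀, hab⟩ := eval_bigMeet.1 hab
  have hm (j : Fin n) : ∃ m, (ρ (2 * j + 2)).r a m ∧ (ρ (2 * j + 3)).r m b :=
    hab _ (List.mem_ofFn.2 ⟨j, rfl⟩)
  choose m hma hmb using hm
  refine ⟨T m, eval_bigMeet.2 ⟨?_, fun s hs => ?_⟩, ?_⟩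
  · have := eval_mixed_of_taylor (ρ := ρ) hT₂ (fun _ => True) (fun _ => a) m (fun i _ => hma i)
      fun i hi => absurd trivial hi
    rwa [hT₁] at this
  · obtain ⟨i, rfl⟩ := List.mem_ofFn.1 hs
    let x (j : Fin n) : A := if u i j then a else b
    let y (j : Fin n) : A := if v i j then a else b
    have hxy : T x = T y := hT₃ i x y a b (fun j hj => if_pos hj) (fun j hj => if_neg hj)
      (fun j hj => if_pos hj) (fun j hj => if_neg hj)
    refine ⟨T x, ?_, ?_, ?_⟩
    · have := hT₂ (ρ 0) (fun _ => a) x fun j => by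
        by_cases hj : u i j
        · simp only [x, if_pos hj]
          exact (ρ 0).iseqv.refl _
        · simp only [x, if_neg hj]
          exact h₀
      rwa [hT₁] at this
    · refine eval_mixed_of_taylor hT₂ _ _ _ (fun j hj => ?_) fun j hj => ?_
      · simp only [x, if_pos hj]
        exact hma j
      · simp only [x, if_neg hj]
        exact (ρ _).iseqv.symm (hmb j)
    · rw [hxy]
      refine eval_mixed_of_taylor hT₂ _ _ _ (fun j hj => ?_) fun j hj => ?_
      · simp only [y, if_pos hj]
        exact hma j
      · simp only [y, if_neg hj]
        exact (ρ _).iseqv.symm (hmb j)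
  · have := eval_mixed_of_taylor (ρ := ρ) hT₂ (fun _ => False) m (fun _ => b) (fun i hi => hi.elim)
      fun i _ => hmb i
    rwa [hT₁] at this

end Satisfies

/-! ### The inclusion fails for equivalence relations on a finite set -/

section Fails

variable {n : ℕ}

/-- The congruence of a set given by the kernel of a map. -/
def kernel {X : Type u} [Variety.sets.{u}.lang.Structure X] {Y : Type*} (f : X → Y) :
    Congruence Variety.sets.{u}.lang X where
  toSetoid := Setoid.ker f
  compatible g := nomatch g

/-- The set of two endpoints and `n` further points. -/
abbrev Points (n : ℕ) : Type u := ULift.{u} (Bool ⊕ Fin n)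

open Classical in
/-- The map which sends the points in `c` to the endpoint `true` and the other points in `d` to the
endpoint `false`. -/
noncomputable def collapse (c d : Fin n → Prop) : Points.{u} n → Bool ⊕ Fin n
  | ⟨.inl b⟩ => .inl b
  | ⟨.inr j⟩ => if c j then .inl true else if d j then .inl false else .inr j

/-- The generic congruences for the left-hand side of the inclusion. -/
noncomputable def genericCong (n : ℕ) [Variety.sets.{u}.lang.Structure (Points.{u} n)] (i : ℕ) :
    Congruence Variety.sets.{u}.lang (Points.{u} n) :=
  if i = 0 then kernel (fun x => x.down.getRight?) else
  if i = 1 then kernel id else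
  if i % 2 = 0 then kernel (collapse (fun j => (j : ℕ) = (i - 2) / 2) fun _ => False) else
    kernel (collapse (fun _ => False) fun j => (j : ℕ) = (i - 3) / 2)

variable [Variety.sets.{u}.lang.Structure (Points.{u} n)]

theorem genericCong_left (j : Fin n) :
    genericCong.{u} n (2 * j + 2) = kernel (collapse (fun k => k = j) fun _ => False) := by
  rw [genericCong, if_neg (by omega), if_neg (by omega), if_pos (by omega)]
  simp [Fin.ext_iff]

theorem genericCong_right (j : Fin n) :
    genericCong.{u} n (2 * j + 3) = kernel (collapse (fun _ => False) fun k => k = j) := by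
  rw [genericCong, if_neg (by omega), if_neg (by omega), if_neg (by omega)]
  simp [Fin.ext_iff]

/-- Point `j` is the midpoint of the `j`-th composition, and variable `0` identifies the two
endpoints and nothing else. -/
theorem eval_taylorLeft_generic :
    (taylorLeft n).eval Variety.sets.{u}.lang (genericCong n) ⟨.inl true⟩ ⟨.inl false⟩ := by
  refine eval_bigMeet.2 ⟨rfl, fun s hs => ?_⟩
  obtain ⟨j, rfl⟩ := List.mem_ofFn.1 hs
  refine ⟨⟨.inr j⟩, ?_, ?_⟩
  · change (genericCong n (2 * j + 2)).r _ _
    rw [genericCong_left]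
    change collapse _ _ _ = collapse _ _ _
    simp [collapse]
  · change (genericCong n (2 * j + 3)).r _ _
    rw [genericCong_right]
    change collapse _ _ _ = collapse _ _ _
    simp [collapse]

/-- Every congruence in the join lies in the kernel of the map sending points in `c` to `true` and
the rest to `false`. In particular the endpoints stay apart. -/
theorem collapse_eq_of_eval_mixed {c : Fin n → Prop} {a b : Points.{u} n}
    (h : (mixed c).eval Variety.sets.{u}.lang (genericCong n) a b) :
    collapse c (fun _ => True) a = collapse c (fun _ => True) b := by
  classical
  refine eval_bigJoin_le (kernel (collapse c fun _ => True)) ?_ ?_ h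
  · rintro a b (h : id a = id b)
    obtain rfl : a = b := h
    rfl
  · intro s hs a b hab
    obtain ⟨j, rfl⟩ := List.mem_ofFn.1 hs
    change collapse _ _ _ = collapse _ _ _
    by_cases hj : c j
    · simp only [if_pos hj] at hab
      change (genericCong n (2 * j + 2)).r _ _ at hab
      rw [genericCong_left] at hab
      change collapse _ _ _ = collapse _ _ _ at hab
      obtain ⟨a | a⟩ := a <;> obtain ⟨b | b⟩ := b <;> simp only [collapse] at hab ⊢ <;>
        (try split_ifs at hab ⊢) <;> simp_all
    · simp only [if_neg hj] at hab
      change (genericCong n (2 * j + 3)).r _ _ at hab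
      rw [genericCong_right] at hab
      change collapse _ _ _ = collapse _ _ _ at hab
      obtain ⟨a | a⟩ := a <;> obtain ⟨b | b⟩ := b <;> simp only [collapse] at hab ⊢ <;>
        (try split_ifs at hab ⊢) <;> simp_all

/-- The middle point cannot be an endpoint: the first factor would force `true` and the last
`false`. If it is point `j`, row `j` yields an endpoint which is `true` because `u j j` holds and
`false` because `v j j` fails. -/
theorem not_eval_taylorRight_generic {u v : Fin n → Fin n → Prop}
    (huv : ∀ w, u w w ∧ ¬ v w w) :
    ¬ (taylorRight u v).eval Variety.sets.{u}.lang (genericCong n) ⟨.inl true⟩ ⟨.inl false⟩ := by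
  rintro ⟨m, h₁, h₂⟩
  obtain ⟨h₁, h₃⟩ := eval_bigMeet.1 h₁
  have h₁ := collapse_eq_of_eval_mixed h₁
  have h₂ := collapse_eq_of_eval_mixed h₂
  obtain ⟨m | j⟩ := m
  · simp only [collapse] at h₁ h₂
    simp_all
  · obtain ⟨x, hx, hu, hv⟩ := h₃ _ (List.mem_ofFn.2 ⟨j, rfl⟩)
    have hu := collapse_eq_of_eval_mixed hu
    have hv := collapse_eq_of_eval_mixed hv
    have hx : Sum.getRight? (.inl true) = x.down.getRight? := hx
    obtain ⟨x | k⟩ := x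
    · simp only [collapse, if_pos (huv j).1, if_neg (huv j).2] at hu hv
      simp_all
    · simp at hx

end Fails

theorem exists_congEquation_of_hasTaylorOp {V : Variety.{u}} {n : ℕ} {u v : Fin n → Fin n → Prop}
    (huv : ∀ w, u w w ∧ ¬ v w w)
    (h : ∀ (A : Type u) [Nonempty A] [V.lang.Structure A], V.Models A → HasTaylorOp V.lang A u v) :
    ∃ e : CongEquation, V.SatisfiesCong e ∧ ¬ CongEquation.IsTrivial.{u} e := by
  -- The inclusion of the left in the right term is expressed as an equation by means of the meet.
  refine ⟨⟨meet (taylorLeft n) (taylorRight u v), taylorLeft n⟩, ?_, fun htriv => ?_⟩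
  · intro A _ _ hA ρ
    funext a b
    exact propext ⟨And.left, fun hab => ⟨hab, eval_taylorRight (h A hA) hab⟩⟩
  · let _ : Variety.sets.{u}.lang.Structure (Points.{u} n) :=
      ⟨fun f _ => (nomatch f), fun r _ => (nomatch r)⟩
    have := Variety.sets.{u}.isAlgebraic
    have heq := htriv Variety.sets.{u}.lang (Points.{u} n) (genericCong n)
    have hl := eval_taylorLeft_generic.{u} (n := n)
    exact not_eval_taylorRight_generic huv ((congrFun (congrFun heq _) _).mpr hl).2

/-! ### Joins as equivalence closures -/

section EqvGen

variable {L : FirstOrder.Language.{u, 0}} {A : Type u} [L.Structure A]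

/-- A reflexive relation which is compatible with the operations. -/
structure IsReflCompatible (L : FirstOrder.Language.{u, 0}) {A : Type u} [L.Structure A]
    (R : A → A → Prop) : Prop where
  refl : ∀ a, R a a
  compatible : ∀ {n : ℕ} (f : L.Functions n) (x y : Fin n → A), (∀ i, R (x i) (y i)) →
    R (Structure.funMap f x) (Structure.funMap f y)

theorem Congruence.isReflCompatible (θ : Congruence L A) : IsReflCompatible L θ.r :=
  ⟨θ.iseqv.refl, θ.compatible⟩

theorem isReflCompatible_eval (ρ : ℕ → Congruence L A) (t : CongTerm) :
    IsReflCompatible L (t.eval L ρ) := by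
  induction t with
  | var i => exact (ρ i).isReflCompatible
  | join s t _ _ => exact (CongTerm.joinCong L (s.eval L ρ) (t.eval L ρ)).isReflCompatible
  | meet s t hs ht =>
    exact ⟨fun a => ⟨hs.refl a, ht.refl a⟩, fun f x y h =>
      ⟨hs.compatible f x y fun i => (h i).1, ht.compatible f x y fun i => (h i).2⟩⟩
  | comp s t hs ht =>
    refine ⟨fun a => ⟨a, hs.refl a, ht.refl a⟩, fun f x y h => ?_⟩
    choose z hz using h
    exact ⟨_, hs.compatible f x z fun i => (hz i).1, ht.compatible f z y fun i => (hz i).2⟩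

/-- Reflexivity allows the arguments to be changed one at a time, so the equivalence closure is
already a congruence. Joins of evaluated terms thus depend on the underlying sets only, which
permits comparing algebras of different types. -/
theorem eqvGen_compatible {R S : A → A → Prop} (hR : IsReflCompatible L R)
    (hS : IsReflCompatible L S) {n : ℕ} (f : L.Functions n) (x y : Fin n → A)
    (h : ∀ i, Relation.EqvGen (fun a b => R a b ∨ S a b) (x i) (y i)) :
    Relation.EqvGen (fun a b => R a b ∨ S a b) (Structure.funMap f x) (Structure.funMap f y) := by
  classical
  have step (z : Fin n → A) (i : Fin n) {a b : A}
      (hab : Relation.EqvGen (fun a b => R a b ∨ S a b) a b) :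
      Relation.EqvGen (fun a b => R a b ∨ S a b) (Structure.funMap f (Function.update z i a))
        (Structure.funMap f (Function.update z i b)) := by
    have update_rel {Q : A → A → Prop} (hQ : IsReflCompatible L Q) {a b : A} (hab : Q a b) :
        Q (Structure.funMap f (Function.update z i a))
          (Structure.funMap f (Function.update z i b)) := by
      refine hQ.compatible f _ _ fun j => ?_
      by_cases hj : j = i
      · subst hj
        simpa using hab
      · simpa [hj] using hQ.refl _
    induction hab with
    | rel a b hab => exact .rel _ _ (hab.imp (update_rel hR) (update_rel hS))
    | refl a => exact .refl _
    | symm a b _ ih => exact ih.symm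
    | trans a b c _ _ ih₁ ih₂ => exact ih₁.trans _ _ _ ih₂
  have key (s : Finset (Fin n)) : Relation.EqvGen (fun a b => R a b ∨ S a b)
      (Structure.funMap f x) (Structure.funMap f (s.piecewise y x)) := by
    induction s using Finset.induction_on with
    | empty => simpa using Relation.EqvGen.refl _
    | insert i s hi ih =>
      refine ih.trans _ _ _ ?_
      have := step (s.piecewise y x) i (h i)
      rw [Finset.piecewise_insert]
      rwa [← Finset.piecewise_eq_of_notMem s y x hi, Function.update_eq_self] at this
  simpa using key Finset.univ

theorem eqvGen_of_joinRel {R S : A → A → Prop} (hR : IsReflCompatible L R)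
    (hS : IsReflCompatible L S) {a b : A} (h : joinRel L R S a b) :
    Relation.EqvGen (fun a b => R a b ∨ S a b) a b :=
  h ⟨Relation.EqvGen.setoid _, eqvGen_compatible hR hS⟩ (fun _ _ h => .rel _ _ (.inl h))
    fun _ _ h => .rel _ _ (.inr h)

theorem rel_of_eqvGen {R S : A → A → Prop} {s : Setoid A} (hR : ∀ a b, R a b → s.r a b)
    (hS : ∀ a b, S a b → s.r a b) {a b : A} (h : Relation.EqvGen (fun a b => R a b ∨ S a b) a b) :
    s.r a b := by
  induction h with
  | rel a b hab => exact hab.elim (hR _ _) (hS _ _)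
  | refl a => exact s.iseqv.refl a
  | symm a b _ ih => exact s.iseqv.symm ih
  | trans a b c _ _ ih₁ ih₂ => exact s.iseqv.trans ih₁ ih₂

end EqvGen

/-! ### Transfer of evaluations -/

section Transfer

variable {L M : FirstOrder.Language.{u, 0}} {A B : Type u} [L.Structure A] [M.Structure B]
  {ρ : ℕ → Congruence L A} {σ : ℕ → Congruence M B}

/-- Evaluations are preserved by maps of sets which preserve the values of the variables. -/
theorem eval_map {g : A → B} (hg : ∀ i a b, (ρ i).r a b → (σ i).r (g a) (g b)) (t : CongTerm)
    {a b : A} (h : t.eval L ρ a b) : t.eval M σ (g a) (g b) := by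
  induction t generalizing a b with
  | var i => exact hg i a b h
  | join s t hs ht =>
    intro θ h₁ h₂
    have := eqvGen_of_joinRel (isReflCompatible_eval ρ s) (isReflCompatible_eval ρ t) h
    exact rel_of_eqvGen (s := θ.toSetoid.comap g) (fun a b hab => h₁ _ _ (hs hab))
      (fun a b hab => h₂ _ _ (ht hab)) this
  | meet s t hs ht => exact ⟨hs h.1, ht h.2⟩
  | comp s t hs ht =>
    obtain ⟨c, h₁, h₂⟩ := h
    exact ⟨g c, hs h₁, ht h₂⟩

/-- It keeps all elements of a finite witness in one class of `κ`; later this class expresses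
idempotence. -/
theorem eval_le {κ : Congruence M B} (hκ : ∀ i a b, (σ i).r a b → κ.r a b) (t : CongTerm)
    {a b : B} (h : t.eval M σ a b) : κ.r a b := by
  induction t generalizing a b with
  | var i => exact hκ i a b h
  | join s t hs ht => exact h κ (fun _ _ => hs) fun _ _ => ht
  | meet s t hs ht => exact hs h.1
  | comp s t hs ht =>
    obtain ⟨c, h₁, h₂⟩ := h
    exact κ.iseqv.trans (hs h₁) (ht h₂)

/-- An evaluation has a finite witness: it is preserved by every map which preserves finitely many
instances of the values of the variables. -/
theorem exists_finite_witness {κ : Congruence M B} (hκ : ∀ i a b, (σ i).r a b → κ.r a b)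
    (t : CongTerm) {a b : B} (h : t.eval M σ a b) :
    ∃ D : Set (ℕ × B × B), D.Finite ∧ (∀ d ∈ D, (σ d.1).r d.2.1 d.2.2 ∧ κ.r a d.2.1) ∧
      ∀ g : B → A, (∀ d ∈ D, (ρ d.1).r (g d.2.1) (g d.2.2)) → t.eval L ρ (g a) (g b) := by
  induction t generalizing a b with
  | var i =>
    refine ⟨{(i, a, b)}, Set.finite_singleton _, ?_, fun g hg => hg _ rfl⟩
    rintro _ rfl
    exact ⟨h, κ.iseqv.refl _⟩
  | join s t hs ht =>
    -- Membership in a join is now a finite zigzag, and the witnesses of its steps are collected.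
    replace h := eqvGen_of_joinRel (isReflCompatible_eval σ s) (isReflCompatible_eval σ t) h
    induction h with
    | rel a b hab =>
      obtain hab | hab := hab
      · obtain ⟨D, h₁, h₂, h₃⟩ := hs hab
        exact ⟨D, h₁, h₂, fun g hg θ k _ => k _ _ (h₃ g hg)⟩
      · obtain ⟨D, h₁, h₂, h₃⟩ := ht hab
        exact ⟨D, h₁, h₂, fun g hg θ _ k => k _ _ (h₃ g hg)⟩
    | refl a => exact ⟨∅, Set.finite_empty, by simp, fun g _ θ _ _ => θ.iseqv.refl _⟩
    | symm a b hab ih =>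
      obtain ⟨D, h₁, h₂, h₃⟩ := ih
      have hab : κ.r a b := rel_of_eqvGen (fun _ _ => eval_le hκ s) (fun _ _ => eval_le hκ t) hab
      exact ⟨D, h₁, fun d hd => ⟨(h₂ d hd).1, κ.iseqv.trans (κ.iseqv.symm hab) (h₂ d hd).2⟩,
        fun g hg θ k₁ k₂ => θ.iseqv.symm (h₃ g hg θ k₁ k₂)⟩
    | trans a b c hab _ ih₁ ih₂ =>
      obtain ⟨D, h₁, h₂, h₃⟩ := ih₁
      obtain ⟨E, k₁, k₂, k₃⟩ := ih₂
      have hab : κ.r a b := rel_of_eqvGen (fun _ _ => eval_le hκ s) (fun _ _ => eval_le hκ t) hab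
      refine ⟨D ∪ E, h₁.union k₁, ?_, fun g hg θ l₁ l₂ => θ.iseqv.trans
        (h₃ g (fun d hd => hg d (.inl hd)) θ l₁ l₂) (k₃ g (fun d hd => hg d (.inr hd)) θ l₁ l₂)⟩
      rintro d (hd | hd)
      · exact h₂ d hd
      · exact ⟨(k₂ d hd).1, κ.iseqv.trans hab (k₂ d hd).2⟩
  | meet s t hs ht =>
    obtain ⟨D, h₁, h₂, h₃⟩ := hs h.1
    obtain ⟨E, k₁, k₂, k₃⟩ := ht h.2
    refine ⟨D ∪ E, h₁.union k₁, ?_, fun g hg =>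
      ⟨h₃ g fun d hd => hg d (.inl hd), k₃ g fun d hd => hg d (.inr hd)⟩⟩
    rintro d (hd | hd)
    · exact h₂ d hd
    · exact k₂ d hd
  | comp s t hs ht =>
    obtain ⟨c, hac, hcb⟩ := h
    obtain ⟨D, h₁, h₂, h₃⟩ := hs hac
    obtain ⟨E, k₁, k₂, k₃⟩ := ht hcb
    refine ⟨D ∪ E, h₁.union k₁, ?_, fun g hg =>
      ⟨g c, h₃ g fun d hd => hg d (.inl hd), k₃ g fun d hd => hg d (.inr hd)⟩⟩
    rintro d (hd | hd)
    · exact h₂ d hd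
    · exact ⟨(k₂ d hd).1, κ.iseqv.trans (eval_le hκ s hac) (k₂ d hd).2⟩

end Transfer

/-! ### Free algebras -/

namespace Variety

variable (V : Variety.{u}) {X : Type u}

instance instStructureTerm (X : Type*) : V.lang.Structure (V.lang.Term X) :=
  termStructure V.lang V.isAlgebraic X

/-- Two terms over a set `X` of variables are related if they agree in all models of `V` under all
assignments which are constant on the classes of a given equivalence relation. -/
def termCong (s : Setoid X) : Congruence V.lang (V.lang.Term X) where
  r p q := ∀ (A : Type u) [Nonempty A] [V.lang.Structure A], V.Models A → ∀ v : X → A,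
    (∀ x y, s.r x y → v x = v y) → p.realize v = q.realize v
  iseqv := ⟨fun _ _ _ _ _ _ _ => rfl, fun h A _ _ hA v hv => (h A hA v hv).symm,
    fun h k A _ _ hA v hv => (h A hA v hv).trans (k A hA v hv)⟩
  compatible f _ _ h A _ _ hA v hv :=
    congrArg (Structure.funMap f) (funext fun i => h i A hA v hv)

theorem termCong_le {s t : Setoid X} (h : ∀ x y, s.r x y → t.r x y) {p q : V.lang.Term X}
    (hpq : (V.termCong s).r p q) : (V.termCong t).r p q :=
  fun A _ _ hA v hv => hpq A hA v fun x y hxy => hv x y (h x y hxy)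

variable (X) in
/-- The free algebra over a set of variables. -/
abbrev Free : Type u := Quotient (V.termCong (⊥ : Setoid X)).toSetoid

/-- The class of a term in the free algebra. -/
def freeMk (t : V.lang.Term X) : V.Free X := Quotient.mk (V.termCong (⊥ : Setoid X)).toSetoid t

noncomputable instance instStructureFree : V.lang.Structure (V.Free X) :=
  (V.termCong (⊥ : Setoid X)).quotientStructure V.isAlgebraic

theorem realize_freeMk {β : Type*} (t : V.lang.Term β) (v : β → V.lang.Term X) :
    (t.realize fun i => V.freeMk (v i)) = V.freeMk (t.subst v) := by
  rw [← realize_termStructure V.isAlgebraic t v]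
  exact (V.termCong ⊥).realize_quotientStructure _ t v

theorem models_free : V.Models (V.Free X) := by
  intro e he v
  obtain ⟨r, rfl⟩ : ∃ r : ℕ → V.lang.Term X, v = fun i => V.freeMk (r i) :=
    ⟨fun i => (v i).out, funext fun i => (Quotient.out_eq _).symm⟩
  rw [V.realize_freeMk, V.realize_freeMk]
  refine Quotient.sound (s := (V.termCong (⊥ : Setoid X)).toSetoid) fun A _ _ hA w _ => ?_
  rw [Term.realize_subst, Term.realize_subst]
  exact hA e he _

theorem termCong_out_freeMk (s : Setoid X) (t : V.lang.Term X) :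
    (V.termCong s).r (V.freeMk t).out t :=
  V.termCong_le (fun x y (h : x = y) => h ▸ s.iseqv.refl x)
    (Quotient.exact (s := (V.termCong (⊥ : Setoid X)).toSetoid) (Quotient.out_eq _))

/-- The congruence of the free algebra determined by an equivalence relation on the variables. -/
def freeCong (s : Setoid X) : Congruence V.lang (V.Free X) where
  r p q := (V.termCong s).r p.out q.out
  iseqv := ⟨fun _ => (V.termCong s).iseqv.refl _, (V.termCong s).iseqv.symm,
    (V.termCong s).iseqv.trans⟩
  compatible f _ _ h := (V.termCong s).iseqv.trans (V.termCong_out_freeMk s _)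
    ((V.termCong s).iseqv.trans ((V.termCong s).compatible f _ _ h)
      ((V.termCong s).iseqv.symm (V.termCong_out_freeMk s _)))

/-- The generators of the free algebra. -/
def gen (x : X) : V.Free X := V.freeMk (.var x)

theorem realize_out_gen (x : X) {A : Type u} [Nonempty A] [V.lang.Structure A] (hA : V.Models A)
    (v : X → A) : (V.gen x).out.realize v = v x :=
  V.termCong_out_freeMk ⊥ (.var x) A hA v fun _ _ h => congrArg v h

theorem freeCong_gen {s : Setoid X} {x y : X} (h : s.r x y) :
    (V.freeCong s).r (V.gen x) (V.gen y) := by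
  intro A _ _ hA v hv
  rw [V.realize_out_gen x hA, V.realize_out_gen y hA, hv x y h]

/-! ### The idempotent Mal'cev condition of a congruence equation -/

/-- Operation symbols indexed by a set, all of the same arity. -/
inductive UniformFunctions (K : Type u) (N : ℕ) : ℕ → Type u
  | op (k : K) : UniformFunctions K N N

/-- The similarity type with operations of arity `N` indexed by a set. -/
abbrev uniformLang (K : Type u) (N : ℕ) : FirstOrder.Language.{u, 0} :=
  ⟨UniformFunctions K N, fun _ => Empty⟩

/-- The result of applying an operation to a list of variables. -/
abbrev opTerm {K : Type u} {N : ℕ} (k : K) (h : Fin N → ℕ) : (uniformLang K N).Term ℕ :=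
  .func (UniformFunctions.op k) fun r => .var (h r)

/-- The variety with idempotent operations `op k` of arity `N`, which satisfies the given
identities between the operations applied to variables, and such that some of the operations are
projections. -/
def uniformVariety {K : Type u} {N : ℕ} (E : Set ((Fin N → ℕ) × K × K)) (G : Set (K × Fin N)) :
    Variety.{u} where
  lang := uniformLang K N
  isAlgebraic := fun _ => inferInstanceAs (IsEmpty Empty)
  eqns := Set.range (fun k => (opTerm k fun _ => 0, .var 0)) ∪
    (fun e => (opTerm e.2.1 e.1, opTerm e.2.2 e.1)) '' E ∪
    (fun g => (opTerm g.1 fun r => r, .var (g.2 : ℕ))) '' G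

section Uniform

variable {K : Type u} {N : ℕ} {E : Set ((Fin N → ℕ) × K × K)} {G : Set (K × Fin N)}

variable (E G) in
/-- The basic operations. -/
abbrev opSymbol (k : K) : (uniformVariety E G).lang.Functions N := UniformFunctions.op k

theorem models_uniformVariety {A : Type u} [(uniformVariety E G).lang.Structure A] :
    (uniformVariety E G).Models A ↔
    (∀ k (a : A), Structure.funMap (opSymbol E G k) (fun _ => a) = a) ∧
    (∀ e ∈ E, ∀ v : ℕ → A, Structure.funMap (opSymbol E G e.2.1) (fun r => v (e.1 r)) =
      Structure.funMap (opSymbol E G e.2.2) (fun r => v (e.1 r))) ∧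
    ∀ g ∈ G, ∀ v : ℕ → A, Structure.funMap (opSymbol E G g.1) (fun r => v r) = v g.2 := by
  constructor
  · intro h
    exact ⟨fun k a => h _ (.inl (.inl ⟨k, rfl⟩)) fun _ => a,
      fun e he v => h _ (.inl (.inr ⟨e, he, rfl⟩)) v, fun g hg v => h _ (.inr ⟨g, hg, rfl⟩) v⟩
  · rintro ⟨h₁, h₂, h₃⟩ _ ((⟨k, rfl⟩ | ⟨e, he, rfl⟩) | ⟨g, hg, rfl⟩) v
    · exact h₁ k (v 0)
    · exact h₂ e he v
    · exact h₃ g hg v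

/-- The assignment which sends the basic operations to given terms. -/
def uniformAssignment {V : Variety.{u}} (t : K → V.lang.Term (Fin (N + 1))) (n : ℕ) :
    UniformFunctions K N n → V.lang.Term (Fin (n + 1))
  | .op k => t k

theorem isIdempotent_uniformVariety : (uniformVariety E G).IsIdempotent := by
  rintro _ ⟨k⟩ A _ _ hA v
  exact (models_uniformVariety.1 hA).1 k (v 0)

theorem isFinitelyPresented_uniformVariety [Finite K] (hE : E.Finite) (hG : G.Finite) :
    (uniformVariety E G).IsFinitelyPresented := by
  refine ⟨?_, ((Set.finite_range _).union (hE.image _)).union (hG.image _)⟩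
  refine Finite.of_surjective (α := K) (fun k => ⟨N, .op k⟩) ?_
  rintro ⟨_, ⟨k⟩⟩
  exact ⟨k, rfl⟩

end Uniform

/-- The equivalence relation `s` restricted to finitely many points: a choice of representatives. -/
theorem exists_representatives {X : Type*} (s : Setoid X) {N : ℕ} (y : Fin N → X) :
    ∃ h : Fin N → Fin N, (∀ r, s.r (y r) (y (h r))) ∧ ∀ r r', s.r (y r) (y r') → h r = h r' := by
  let q := s.comap y
  refine ⟨fun r => (Quotient.mk q r).out, fun r => ?_, fun r r' hr => ?_⟩
  · exact s.iseqv.symm (Quotient.exact (s := q) (Quotient.out_eq (Quotient.mk q r)))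
  · exact congrArg Quotient.out (Quotient.sound (s := q) hr)

/-- If an inclusion of evaluations holds in the free algebra of `V` but fails in a set, then `V`
satisfies an idempotent Mal'cev condition which fails in the variety of sets. -/
theorem exists_uniformVariety {L : FirstOrder.Language.{u, 0}} {X : Type u} [L.Structure X]
    (ρ : ℕ → Congruence L X) (t : CongTerm) {x₁ x₂ : X}
    (h : t.eval V.lang (fun i => V.freeCong (ρ i).toSetoid) (V.gen x₁) (V.gen x₂))
    (hX : ¬ t.eval L ρ x₁ x₂) :
    ∃ U : Variety.{u}, U.IsIdempotent ∧ U.IsFinitelyPresented ∧ U ≤ V ∧ ¬ U ≤ Variety.sets := by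
  classical
  obtain ⟨D, hD, hD', hD''⟩ := exists_finite_witness (ρ := ρ) (κ := V.freeCong ⊤)
    (fun i a b hab => V.termCong_le (fun _ _ _ => trivial) hab) t h
  -- The finitely many elements of the free algebra which occur in the witness.
  let Kset : Set (V.Free X) := {V.gen x₁, V.gen x₂} ∪
    ((fun d => d.2.1) '' D ∪ (fun d => d.2.2) '' D)
  have hKfin : Kset.Finite :=
    (Set.toFinite _).union ((hD.image _).union (hD.image _))
  -- Being congruent to a generator when all variables are identified means that the element is an
  -- idempotent term.
  have hK (k : V.Free X) (hk : k ∈ Kset) : (V.freeCong ⊤).r (V.gen x₁) k := by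
    have htop (x : X) : (V.freeCong ⊤).r (V.gen x₁) (V.gen x) := V.freeCong_gen trivial
    obtain (rfl | rfl) | (⟨d, hd, rfl⟩ | ⟨d, hd, rfl⟩) := hk
    · exact htop _
    · exact htop _
    · exact (hD' d hd).2
    · exact (V.freeCong ⊤).iseqv.trans (hD' d hd).2
        (V.termCong_le (fun _ _ _ => trivial) (hD' d hd).1)
  have hD₁ (d) (hd : d ∈ D) : d.2.1 ∈ Kset := .inr (.inl ⟨d, hd, rfl⟩)
  have hD₂ (d) (hd : d ∈ D) : d.2.2 ∈ Kset := .inr (.inr ⟨d, hd, rfl⟩)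
  let K : Type u := Kset
  have : Finite K := hKfin.to_subtype
  have := Fintype.ofFinite K
  let k₁ : K := ⟨V.gen x₁, .inl (.inl rfl)⟩
  let k₂ : K := ⟨V.gen x₂, .inl (.inr rfl)⟩
  -- The finitely many variables which occur in these elements.
  choose supp hsupp using fun k : K => exists_finset_support k.1.out
  let Y : Finset X := {x₁, x₂} ∪ Finset.univ.biUnion supp
  have hY (k : K) : supp k ⊆ Y := fun x hx =>
    Finset.mem_union_right _ (Finset.mem_biUnion.2 ⟨k, Finset.mem_univ _, hx⟩)
  let N := Y.card
  let y (r : Fin N) : X := (Y.equivFin.symm r).1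
  let idx (x : X) (hx : x ∈ Y) : Fin N := Y.equivFin ⟨x, hx⟩
  have y_idx (x : X) (hx : x ∈ Y) : y (idx x hx) = x := by simp [y, idx]
  have idx_y (r : Fin N) (hx : y r ∈ Y) : idx (y r) hx = r := by simp [y, idx]
  have hx₁ : x₁ ∈ Y := by simp [Y]
  have hx₂ : x₂ ∈ Y := by simp [Y]
  choose hr hr₁ hr₂ using fun i => exists_representatives (ρ i).toSetoid y
  -- Each instance `(i, p, q)` of the witness becomes the identity `p ≈ q` with variables identified
  -- along `ρ i`. The set `G` makes the two generators projections.
  let E : Set ((Fin N → ℕ) × K × K) :=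
    Set.range fun d : D => (fun r => (hr d.1.1 r : ℕ), ⟨d.1.2.1, hD₁ d.1 d.2⟩, ⟨d.1.2.2, hD₂ d.1 d.2⟩)
  let G : Set (K × Fin N) := {(k₁, idx x₁ hx₁), (k₂, idx x₂ hx₂)}
  have : Finite D := hD.to_subtype
  refine ⟨uniformVariety E G, isIdempotent_uniformVariety,
    isFinitelyPresented_uniformVariety (Set.finite_range _) (Set.toFinite _), ?_, fun hU => hX ?_⟩
  -- Each operation is interpreted by the element of the free algebra that it stands for. Variables
  -- outside `Y` do not influence its value and are sent to the dummy.
  · let ι (x : X) : Fin (N + 1) := if hx : x ∈ Y then (idx x hx).succ else 0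
    let τ : Assignment (uniformVariety E G) V :=
      uniformAssignment fun k => k.1.out.relabel ι
    have realize_τ {A : Type u} [V.lang.Structure A] (k : K) (a : A) (z : Fin N → A) (v : X → A)
        (hv : ∀ r, v (y r) = z r) :
        (τ N (opSymbol E G k)).realize (Fin.cons a z : Fin (N + 1) → A) = k.1.out.realize v := by
      refine Term.realize_relabel.trans (hsupp k A _ _ fun x hx => ?_)
      have hx := hY k hx
      simp only [Function.comp, ι, dif_pos hx, Fin.cons_succ]
      rw [← hv, y_idx]
    refine IsInterpreting.le (τ := τ) ⟨?_, ?_⟩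
    · rintro A _ _ hA _ ⟨k⟩ a b z
      let v (x : X) : A := if hx : x ∈ Y then z (idx x hx) else a
      have hv (r : Fin N) : v (y r) = z r := by
        have : y r ∈ Y := Subtype.coe_prop _
        simp only [v, dif_pos this, idx_y]
      exact (realize_τ k a z v hv).trans (realize_τ k b z v hv).symm
    · intro A _ _ hA a
      let _ := reduct τ a
      refine models_uniformVariety.2 ⟨fun k b => ?_, ?_, ?_⟩
      · refine (realize_τ k a (fun _ => b) (fun _ => b) fun _ => rfl).trans ?_
        rw [← hK k.1 k.2 A hA (fun _ => b) fun _ _ _ => rfl]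
        exact V.realize_out_gen x₁ hA _
      · rintro _ ⟨⟨d, hd⟩, rfl⟩ v
        let m (r : Fin N) : Quotient (ρ d.1).toSetoid := Quotient.mk _ (y r)
        let z (r : Fin N) : A := v (hr d.1 r)
        -- This extends the values on `Y` to an assignment constant on the classes of `ρ d.1`, as
        -- the definition of `freeCong` requires.
        let w (x : X) : A := Function.extend m z (fun _ => a) (Quotient.mk _ x)
        have hfac : z.FactorsThrough m := fun r r' hrr => by
          simp only [z]
          rw [hr₂ d.1 r r' (Quotient.exact (s := (ρ d.1).toSetoid) hrr)]
        have hw (r : Fin N) : w (y r) = z r := hfac.extend_apply (fun _ => a) r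
        refine (realize_τ ⟨d.2.1, hD₁ d hd⟩ a z w hw).trans (Eq.trans ?_
          (realize_τ ⟨d.2.2, hD₂ d hd⟩ a z w hw).symm)
        refine (hD' d hd).1 A hA w fun x x' hx => ?_
        exact congrArg (Function.extend m z fun _ => a) (Quotient.sound hx)
      · have hg (x : X) (hx : x ∈ Y) (k : K) (hk : k.1 = V.gen x) (v : ℕ → A) :
            Structure.funMap (opSymbol E G k) (fun r : Fin N => v r) = v (idx x hx) := by
          let z (r : Fin N) : A := v r
          let w (x : X) : A := if hx : x ∈ Y then z (idx x hx) else a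
          have hw (r : Fin N) : w (y r) = z r := by
            have : y r ∈ Y := Subtype.coe_prop _
            simp only [w, dif_pos this, idx_y]
          refine (realize_τ k a z w hw).trans ?_
          rw [hk, V.realize_out_gen x hA]
          exact dif_pos hx
        rintro _ (rfl | rfl) v
        · exact hg x₁ hx₁ k₁ rfl v
        · exact hg x₂ hx₂ k₂ rfl v
  · obtain ⟨τ, hτ⟩ := exists_isInterpreting hU
    have : Nonempty X := ⟨x₁⟩
    let _ : Variety.sets.{u}.lang.Structure X :=
      ⟨fun f _ => (nomatch f), fun r _ => (nomatch r)⟩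
    have hmod := hτ.models X (fun _ he => absurd he (Set.notMem_empty _)) x₁
    let _ := reduct τ x₁
    obtain ⟨-, hE, hG⟩ := models_uniformVariety.1 hmod
    let v (r : ℕ) : X := if hr : r < N then y ⟨r, hr⟩ else x₁
    have hv (r : Fin N) : v r = y r := dif_pos r.2
    -- The operations are evaluated at the actual points of `X` that serve as variables.
    let φ (k : K) : X := Structure.funMap (opSymbol E G k) y
    -- On a bare set every equivalence relation is a congruence, so replacing points by `ρ
    -- i`-representatives keeps the value within its class; there the identities in `E` apply.
    have hφ (k : K) (i : ℕ) :
        (ρ i).r (φ k) (Structure.funMap (opSymbol E G k) fun r => y (hr i r)) := by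
      let θ : Congruence Variety.sets.{u}.lang X := ⟨(ρ i).toSetoid, fun f => nomatch f⟩
      refine θ.realize (τ N (opSymbol E G k)) fun j => ?_
      exact Fin.cases ((ρ i).iseqv.refl _) (hr₁ i) j
    have hφG (k : K) (r : Fin N) (hk : (k, r) ∈ G) : φ k = y r := by
      have := hG _ hk v
      simp only [hv] at this
      exact this
    let g (p : V.Free X) : X := if hp : p ∈ Kset then φ ⟨p, hp⟩ else x₁
    have hg (k : K) : g k.1 = φ k := dif_pos k.2
    have := hD'' g fun d hd => by
      have e := hE _ ⟨⟨d, hd⟩, rfl⟩ v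
      simp only [hv] at e
      rw [hg ⟨d.2.1, hD₁ d hd⟩, hg ⟨d.2.2, hD₂ d hd⟩]
      refine (ρ d.1).iseqv.trans (hφ _ d.1) ?_
      rw [e]
      exact (ρ d.1).iseqv.symm (hφ _ d.1)
    rwa [hg k₁, hg k₂, hφG k₁ _ (.inl rfl), hφG k₂ _ (.inr rfl), y_idx, y_idx] at this

/-- Sending points of `X` to generators preserves the side that holds. The equation in the free
algebra gives the other side, which fails in `X`. -/
theorem exists_of_satisfiesCong {V : Variety.{u}} {e : CongEquation} (h : V.SatisfiesCong e)
    (he : ¬ CongEquation.IsTrivial.{u} e) :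
    ∃ U : Variety.{u}, U.IsIdempotent ∧ U.IsFinitelyPresented ∧ U ≤ V ∧ ¬ U ≤ Variety.sets := by
  unfold CongEquation.IsTrivial CongEquation.HoldsIn at he
  push Not at he
  obtain ⟨L, _, X, _, _, ρ, hρ⟩ := he
  have : Nonempty (V.Free X) := ⟨V.gen (Classical.arbitrary X)⟩
  have hV := h (V.Free X) V.models_free fun i => V.freeCong (ρ i).toSetoid
  have hgen (t : CongTerm) {x₁ x₂ : X} (hx : t.eval L ρ x₁ x₂) :
      t.eval V.lang (fun i => V.freeCong (ρ i).toSetoid) (V.gen x₁) (V.gen x₂) :=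
    eval_map (fun i _ _ hxy => V.freeCong_gen hxy) t hx
  by_contra hne
  refine hρ (funext fun x₁ => funext fun x₂ => propext ⟨fun hl => ?_, fun hr => ?_⟩)
  · by_contra hr
    exact hne (V.exists_uniformVariety ρ e.rhs (hV ▸ hgen e.lhs hl) hr)
  · by_contra hl
    exact hne (V.exists_uniformVariety ρ e.lhs (hV ▸ hgen e.rhs hr) hl)

end Variety

end UnivAlg

theorem lemma4p6 (V : UnivAlg.Variety.{u}) :
    V.SatisfiesNontrivialIdempotentMalcevCondition ↔
      ∃ e : UnivAlg.CongEquation,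
        V.SatisfiesCong e ∧ ¬ UnivAlg.CongEquation.IsTrivial.{u} e := by
  rw [UnivAlg.Variety.satisfiesNontrivialIdempotentMalcevCondition_iff]
  constructor
  · rintro ⟨U, h₁, h₂, hUV, hU⟩
    obtain ⟨n, u, v, huv, h⟩ := UnivAlg.Variety.exists_hasTaylorOp h₁ h₂ hU
    exact UnivAlg.exists_congEquation_of_hasTaylorOp huv
      (UnivAlg.Variety.hasTaylorOp_of_le hUV h)
  · rintro ⟨e, h, he⟩
    exact UnivAlg.Variety.exists_of_satisfiesCong h he
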